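/- Let $H=\mathrm{SL}(2,\mathbb R)$, $V=\mathbb R^3$, $G=\mathrm{SL}(3,\mathbb R)$. Let $\Gamma$ be the fundamental group of a closed hyperbolic surface, embedded by an injective morphism $\iota:\Gamma\to H$ with discrete image; that is, $\Gamma$ is torsion-free, $\iota$ is injective, $\iota(\Gamma)$ is discrete and $M=\iota(\Gamma)\backslash H$ is compact. Let $\Phi^t$ be the flow on $M$ induced by right translation by $a^t=\mathrm{diag}(e^t,e^{-t})$. Let $Y$ be the frame variety of triples $([u],[v],[w])$ of non-collinear points of $P(V)$, with its projections $\pi_+([u],[v],[w])=([u],[uv])$ and $\pi_-([u],[v],[w])=([w],[wv])$ to the flag variety (the second entry is the projective line through the two points), and let $E^\pm\subset TY$ be the tangent bundle to the fibres of $\pi_\pm$. For a representation $\rho:\Gamma\to G$ let $E_\rho=\Gamma\backslash(H\times Y)$ be the quotient by $\gamma(h,y)=(\iota(\gamma)h,\rho(\gamma)y)$, with projection $\pi_\rho:E_\rho\to M$, let $\Phi_\rho^t$ be the flow on $E_\rho$ induced by $(h,y)\mapsto(ha^t,y)$, and let $E^\pm_\rho$ be the vertical bundles over $E_\rho$ induced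 by $E^\pm$. The representation $\rho$ is $(G,Y)$-Anosov if there is a continuous section $s$ of $\pi_\rho$ whose image $S$ is $\Phi^t_\rho$-invariant and such that for every continuous norm $\|\cdot\|$ on the vertical tangent bundle of $E_\rho$ there are $a,b>0$ with $$\|D_p\Phi_\rho^{t}(v^+)\|\le b e^{-at}\|v^+\|,\qquad \|D_p\Phi_\rho^{-t}(v^-)\|\le b e^{-at}\|v^-\|$$ for all $p\in S$, $t>0$, $v^+\in E^+_\rho$ over $p$ and $v^-\in E^-_\rho$ over $p$. Let $\rho_0:H\to G$ be the embedding $$\begin{pmatrix}a&b\\c&d\end{pmatrix}\mapsto\begin{pmatrix}a&0&b\\0&1&0\\c&0&d\end{pmatrix},$$ let $\varphi^t=\mathrm{diag}(e^{t/3},e^{-2t/3},e^{t/3})$, and for a morphism $u:\Gamma\to\mathbb R$, i.e. $u\in H^1(\Gamma,\mathbb R)$, let $\rho_u(\gamma)=\varphi^{u(\gamma)}\rho_0(\iota(\gamma))$ be the linear $u$-deformation of the canonical representation $\rho_0\circ\iota$. For $\gamma\in\Gamma$ let $t(\gamma)=2\log r(\gamma)$, where $r(\gamma)$ is the spectral radius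 of $\iota(\gamma)$. For $c\in H_1(\Gamma,\mathbb Z)$ and $n\ge1$ let $t_n(c)$ be the infimum of $t(\gamma)/n$ over all $\gamma\in\Gamma$ representing $nc$. The stable norm of $c$ is $\lim_n t_n(c)$; it extends uniquely to a norm on $H_1(\Gamma,\mathbb R)$, whose dual norm on $H^1(\Gamma,\mathbb R)$ is the stable norm $|u|_s$. Theorem. For every morphism $u:\Gamma\to\mathbb R$, the representation $\rho_u$ is $(G,Y)$-Anosov if and only if $|u|_s<1/2$. -/

import Mathlib

open scoped LinearAlgebra.Projectivization TensorProduct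

noncomputable section

namespace FlagAnosov

/-! ### The groups `H = SL(2,ℝ)`, `G = SL(3,ℝ)` and the diagonal flow -/

/-- The group `H = SL(2,ℝ)`. -/
abbrev H := Matrix.SpecialLinearGroup (Fin 2) ℝ

/-- The vector space `V = ℝ³`. -/
abbrev V := Fin 3 → ℝ

/-- The group `G = SL(V) = SL(3,ℝ)`. -/
abbrev G := Matrix.SpecialLinearGroup (Fin 3) ℝ

/-- The one-parameter subgroup `a^t = diag(e^t, e^{-t})` of `H`. -/
def aFlow (t : ℝ) : H :=
  ⟨!![Real.exp t, 0; 0, Real.exp (-t)], by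
    rw [Matrix.det_fin_two_of, ← Real.exp_add]; simp⟩

/-! ### The frame variety `Y` and its tangent bundle -/

/-- The projective space carries the quotient topology of `V ∖ {0}`. -/
instance projTopology : TopologicalSpace (ℙ ℝ V) :=
  TopologicalSpace.coinduced (Projectivization.mk' ℝ) inferInstance

/-- The frame variety `Y`: triples of non-collinear points of `P(V)`, with the subspace topology
of the product topology. -/
abbrev Frame := {y : Fin 3 → ℙ ℝ V // Projectivization.Independent y}

theorem independent_smul (g : G) {y : Fin 3 → ℙ ℝ V} (hy : Projectivization.Independent y) :
    Projectivization.Independent (g • y) := by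
  rw [Projectivization.independent_iff] at hy
  have hne : ∀ i, g • (y i).rep ≠ 0 := fun i =>
    (smul_ne_zero_iff_ne g).mpr (y i).rep_nonzero
  have h : g • y = fun i => Projectivization.mk ℝ (g • (y i).rep) (hne i) := by
    funext i
    rw [Pi.smul_apply, ← Projectivization.smul_mk g (y i).rep_nonzero, Projectivization.mk_rep]
  rw [h]
  refine Projectivization.Independent.mk _ hne ?_
  exact hy.map' (DistribMulAction.toModuleEnd ℝ V g)
    (LinearMap.ker_eq_bot.mpr (DistribMulAction.toLinearEquiv ℝ V g).injective)

/-- The diagonal action of `G` on the frame variety. -/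
instance frameAction : MulAction G Frame where
  smul g y := ⟨g • y.1, independent_smul g y.2⟩
  one_smul y := Subtype.ext (one_smul G y.1)
  mul_smul g g' y := Subtype.ext (mul_smul g g' y.1)

/-- The endomorphisms of `V` that preserve the subspace `W`. -/
def preserving (W : Submodule ℝ V) : Submodule ℝ (Matrix (Fin 3) (Fin 3) ℝ) where
  carrier := {ξ | ∀ v ∈ W, ξ.mulVec v ∈ W}
  add_mem' hξ hη v hv := by
    rw [Matrix.add_mulVec]; exact W.add_mem (hξ v hv) (hη v hv)
  zero_mem' v _ := by rw [Matrix.zero_mulVec]; exact W.zero_mem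
  smul_mem' c ξ hξ v hv := by
    rw [Matrix.smul_mulVec]; exact W.smul_mem c (hξ v hv)

/-- The infinitesimal stabilizer of the frame `y`: the endomorphisms that preserve its lines. -/
def isotropy (y : Frame) : Submodule ℝ (Matrix (Fin 3) (Fin 3) ℝ) :=
  ⨅ i, preserving (y.1 i).submodule

/-- The tangent space `T_y Y` of the homogeneous space `Y`: the class of `ξ` is the velocity at
`s = 0` of the curve `exp(sξ) • y`, and it vanishes exactly when `ξ` preserves the lines of `y`.
(Scalar endomorphisms act trivially, so `gl(V)` gives the same quotient as `sl(V)`.) -/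
abbrev FrameTangent (y : Frame) := Matrix (Fin 3) (Fin 3) ℝ ⧸ isotropy y

/-- The projection `π₊([u],[v],[w]) = ([u],[uv])` to the flag variety, the flag being given by its
line and its plane in `V`. -/
def piPlus (y : Frame) : Submodule ℝ V × Submodule ℝ V :=
  ((y.1 0).submodule, (y.1 0).submodule ⊔ (y.1 1).submodule)

/-- The projection `π₋([u],[v],[w]) = ([w],[wv])` to the flag variety. -/
def piMinus (y : Frame) : Submodule ℝ V × Submodule ℝ V :=
  ((y.1 2).submodule, (y.1 2).submodule ⊔ (y.1 1).submodule)

/-- The infinitesimal stabilizer of a flag. -/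
def flagIsotropy (x : Submodule ℝ V × Submodule ℝ V) :
    Submodule ℝ (Matrix (Fin 3) (Fin 3) ℝ) :=
  preserving x.1 ⊓ preserving x.2

/-- `E⁺`, the tangent bundle to the fibres of `π₊`: the vectors represented by the `ξ` that
infinitesimally fix `π₊(y)`. -/
def EPlus (y : Frame) : Submodule ℝ (FrameTangent y) :=
  (flagIsotropy (piPlus y)).map (isotropy y).mkQ

/-- `E⁻`, the tangent bundle to the fibres of `π₋`. -/
def EMinus (y : Frame) : Submodule ℝ (FrameTangent y) :=
  (flagIsotropy (piMinus y)).map (isotropy y).mkQ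

/-! ### The closed manifold `M = Γ\H`, the flat bundle `E_ρ` and the flows -/

section Bundle

variable {Γ : Type*} [Group Γ]

/-- The orbit relation of the left translations of `H` by `ι(Γ)`. -/
def orbitSetoid (ι : Γ →* H) : Setoid H where
  r h h' := ∃ γ : Γ, h' = ι γ * h
  iseqv :=
    { refl := fun h => ⟨1, by simp⟩
      symm := by
        rintro h _ ⟨γ, rfl⟩
        exact ⟨γ⁻¹, by simp⟩
      trans := by
        rintro h _ _ ⟨γ, rfl⟩ ⟨δ, rfl⟩
        exact ⟨δ * γ, by simp [mul_assoc]⟩ }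

/-- The quotient `M = ι(Γ)\H`, with the quotient topology. -/
abbrev M (ι : Γ →* H) := Quotient (orbitSetoid ι)

/-- The orbit relation of `γ(h, y) = (ι(γ)h, ρ(γ)y)` on `H × Y`. -/
def bundleSetoid (ι : Γ →* H) (ρ : Γ →* G) : Setoid (H × Frame) where
  r p q := ∃ γ : Γ, q = (ι γ * p.1, ρ γ • p.2)
  iseqv :=
    { refl := fun p => ⟨1, by simp⟩
      symm := by
        rintro p _ ⟨γ, rfl⟩
        exact ⟨γ⁻¹, by simp⟩
      trans := by
        rintro p _ _ ⟨γ, rfl⟩ ⟨δ, rfl⟩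
        exact ⟨δ * γ, by simp [mul_assoc, mul_smul]⟩ }

/-- The total space `E_ρ = Γ\(H × Y)` of the flat `(G,Y)`-bundle, with the quotient topology. -/
abbrev E (ι : Γ →* H) (ρ : Γ →* G) := Quotient (bundleSetoid ι ρ)

/-- The bundle projection `π_ρ : E_ρ → M`. -/
def bundleProj (ι : Γ →* H) (ρ : Γ →* G) : E ι ρ → M ι :=
  Quotient.map Prod.fst (by
    rintro p _ ⟨γ, rfl⟩
    exact ⟨γ, rfl⟩)

/-- The horizontal flow `Φ_ρ^t` on `E_ρ`, induced by `(h, y) ↦ (h a^t, y)`. -/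
def flowE (ι : Γ →* H) (ρ : Γ →* G) (t : ℝ) : E ι ρ → E ι ρ :=
  Quotient.map (fun p => (p.1 * aFlow t, p.2)) (by
    rintro p _ ⟨γ, rfl⟩
    exact ⟨γ, by simp [mul_assoc]⟩)

/-- A continuous norm on the vertical tangent bundle `Γ\(H × TY) = E_ρ⁺ ⊕ E_ρ⁻` of `E_ρ`, written
as a `Γ`-invariant continuous family of norms `‖·‖_{(h,y)}` on the spaces `T_y Y`. The differential
of `y ↦ g y` sends the class of `ξ` at `y` to the class of `g ξ g⁻¹` at `g y`. -/
structure VerticalNorm (ι : Γ →* H) (ρ : Γ →* G) where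
  toSeminorm : H → (y : Frame) → Seminorm ℝ (FrameTangent y)
  definite : ∀ h y (v : FrameTangent y), toSeminorm h y v = 0 → v = 0
  continuous : Continuous fun p : H × Frame × Matrix (Fin 3) (Fin 3) ℝ =>
    toSeminorm p.1 p.2.1 ((isotropy p.2.1).mkQ p.2.2)
  invariant : ∀ (γ : Γ) (h : H) (y : Frame) (ξ : Matrix (Fin 3) (Fin 3) ℝ),
    toSeminorm (ι γ * h) (ρ γ • y)
        ((isotropy (ρ γ • y)).mkQ
          ((ρ γ : Matrix (Fin 3) (Fin 3) ℝ) * ξ * ((ρ γ)⁻¹ : G))) =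
      toSeminorm h y ((isotropy y).mkQ ξ)

/-- `s` is the section of a `(G,Y)`-Anosov structure with representation `ρ` over `(M, Φ^t)`.
The differential of `Φ_ρ^t` sends the vertical vector `v ∈ T_y Y` over `[(h, y)]` to the vertical
vector `v` over `[(h a^t, y)]`. -/
structure IsAnosovSection (ι : Γ →* H) (ρ : Γ →* G) (s : M ι → E ι ρ) : Prop where
  continuous : Continuous s
  isSection : ∀ p, bundleProj ι ρ (s p) = p
  invariant : ∀ t : ℝ, Set.MapsTo (flowE ι ρ t) (Set.range s) (Set.range s)
  hyperbolic : ∀ N : VerticalNorm ι ρ, ∃ a > 0, ∃ b > 0,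
    ∀ (h : H) (y : Frame), (Quotient.mk (bundleSetoid ι ρ) (h, y)) ∈ Set.range s →
      ∀ t : ℝ, 0 < t →
        (∀ v ∈ EPlus y, N.toSeminorm (h * aFlow t) y v ≤
          b * Real.exp (-a * t) * N.toSeminorm h y v) ∧
        (∀ v ∈ EMinus y, N.toSeminorm (h * aFlow (-t)) y v ≤
          b * Real.exp (-a * t) * N.toSeminorm h y v)

/-- The representation `ρ` is `(G,Y)`-Anosov (relative to `ι`). -/
def IsAnosov (ι : Γ →* H) (ρ : Γ →* G) : Prop :=
  ∃ s : M ι → E ι ρ, IsAnosovSection ι ρ s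

/-- `ι` embeds `Γ` in `H` as the fundamental group of a closed hyperbolic surface: it is injective
with discrete image, `Γ` has no torsion, and `M = ι(Γ)\H` is compact. -/
structure IsClosedSurfaceEmbedding (ι : Γ →* H) : Prop where
  injective : Function.Injective ι
  discrete : DiscreteTopology ι.range
  torsionFree : ∀ γ : Γ, γ ≠ 1 → ¬ IsOfFinOrder γ
  cocompact : CompactSpace (M ι)

end Bundle

/-! ### Canonical representations and their linear deformations -/

/-- The matrix of `ρ₀(h)` for a `2 × 2` matrix `h`. -/
def rho0Matrix (h : Matrix (Fin 2) (Fin 2) ℝ) : Matrix (Fin 3) (Fin 3) ℝ :=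
  !![h 0 0, 0, h 0 1;
     0, 1, 0;
     h 1 0, 0, h 1 1]

theorem rho0Matrix_one : rho0Matrix 1 = 1 := by
  ext i j
  fin_cases i <;> fin_cases j <;> simp [rho0Matrix]

theorem rho0Matrix_mul (g h : Matrix (Fin 2) (Fin 2) ℝ) :
    rho0Matrix (g * h) = rho0Matrix g * rho0Matrix h := by
  ext i j
  fin_cases i <;> fin_cases j <;>
    simp [rho0Matrix, Matrix.mul_apply, Fin.sum_univ_two, Fin.sum_univ_three]

theorem rho0Matrix_det (h : Matrix (Fin 2) (Fin 2) ℝ) : (rho0Matrix h).det = h.det := by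
  rw [Matrix.det_fin_two, Matrix.det_fin_three]
  simp [rho0Matrix]

/-- The embedding `ρ₀ : H → G`. -/
def rho0 : H →* G where
  toFun h := ⟨rho0Matrix h.1, (rho0Matrix_det h.1).trans h.2⟩
  map_one' := Subtype.ext rho0Matrix_one
  map_mul' g h := Subtype.ext (rho0Matrix_mul g.1 h.1)

/-- The one-parameter subgroup `φ^t = diag(e^{t/3}, e^{-2t/3}, e^{t/3})` of `G`. -/
def phi (t : ℝ) : G :=
  ⟨!![Real.exp (t / 3), 0, 0; 0, Real.exp (-2 * t / 3), 0; 0, 0, Real.exp (t / 3)], by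
    rw [Matrix.det_fin_three]
    simp [← Real.exp_add]
    ring⟩

theorem phi_zero : phi 0 = 1 := by
  ext i j
  fin_cases i <;> fin_cases j <;> simp [phi]

theorem phi_add (s t : ℝ) : phi (s + t) = phi s * phi t := by
  refine Subtype.ext ?_
  rw [Matrix.SpecialLinearGroup.coe_mul]
  ext i j
  fin_cases i <;> fin_cases j <;>
    simp [phi, Matrix.mul_apply, Fin.sum_univ_three, ← Real.exp_add] <;> ring

theorem phi_comm (t : ℝ) (h : H) : phi t * rho0 h = rho0 h * phi t := by
  refine Subtype.ext ?_
  change (phi t).1 * rho0Matrix h.1 = rho0Matrix h.1 * (phi t).1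
  ext i j
  fin_cases i <;> fin_cases j <;>
    simp [phi, rho0Matrix, Matrix.mul_apply, Fin.sum_univ_three, mul_comm]

section Deformation

variable {Γ : Type*} [Group Γ]

/-- The linear `u`-deformation `ρ_u(γ) = φ^{u(γ)} ρ₀(ι(γ))` of the canonical representation
`ρ₀ ∘ ι`, for a morphism `u : Γ → ℝ`. -/
def linearDeformation (ι : Γ →* H) (u : Γ →* Multiplicative ℝ) : Γ →* G where
  toFun γ := phi (u γ).toAdd * rho0 (ι γ)
  map_one' := by simp [phi_zero]
  map_mul' γ δ := by
    rw [map_mul u, map_mul ι, map_mul rho0, toAdd_mul, phi_add, mul_assoc, mul_assoc,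
      ← mul_assoc (phi (u δ).toAdd), phi_comm, mul_assoc]

/-! ### The stable norm -/

/-- The first homology group `H₁(Γ, ℤ)`. -/
abbrev H1Int (Γ : Type*) [Group Γ] := Additive (Abelianization Γ)

/-- The first homology group `H₁(Γ, ℝ)`. -/
abbrev H1Real (Γ : Type*) [Group Γ] := ℝ ⊗[ℤ] H1Int Γ

/-- The spectral radius `r(γ)` of `ι(γ)`. -/
def specRadius (ι : Γ →* H) (γ : Γ) : ℝ :=
  (spectralRadius ℂ ((ι γ : Matrix (Fin 2) (Fin 2) ℝ).map Complex.ofReal)).toReal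

/-- `t(γ) = 2 log r(γ)`, the length of the closed geodesic associated to `γ`. -/
def transLength (ι : Γ →* H) (γ : Γ) : ℝ :=
  2 * Real.log (specRadius ι γ)

/-- `t_n(c)`: the infimum of `t(γ)/n` over the elements `γ` of `Γ` that represent `n c`. -/
def classLength (ι : Γ →* H) (n : ℕ) (c : H1Int Γ) : ℝ :=
  sInf {x | ∃ γ : Γ, Additive.ofMul (Abelianization.of γ) = n • c ∧ x = transLength ι γ / n}

/-- The stable norm on `H₁(Γ, ℤ)`: the limit of `t_n(c)`. -/
def stableNormInt (ι : Γ →* H) (c : H1Int Γ) : ℝ :=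
  Filter.limUnder Filter.atTop fun n : ℕ => classLength ι n c

/-- The stable norm on `H₁(Γ, ℝ)`: the infimum of `∑ |aᵢ| ‖cᵢ‖` over the expressions
`∑ aᵢ ⊗ cᵢ` of a class with `aᵢ` real and `cᵢ` integral. This is the extension of the stable norm
of `H₁(Γ, ℤ)` to a seminorm on `H₁(Γ, ℝ)`. -/
def stableNormReal (ι : Γ →* H) (c : H1Real Γ) : ℝ :=
  sInf {x | ∃ l : H1Int Γ →₀ ℝ, (l.sum fun e a => a ⊗ₜ[ℤ] e) = c ∧
    x = l.sum fun e a => |a| * stableNormInt ι e}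

/-- The linear form on `H₁(Γ, ℝ)` given by `u ∈ Hom(Γ, ℝ) = H¹(Γ, ℝ)`. -/
def pairing (u : Γ →* Multiplicative ℝ) : H1Real Γ →ₗ[ℝ] ℝ :=
  LinearMap.liftBaseChange ℝ
    (MonoidHom.toAdditiveLeft (Abelianization.lift u)).toIntLinearMap

/-- The stable norm on `H¹(Γ, ℝ)`: the dual norm `sup {|u(c)| : ‖c‖ ≤ 1}`. -/
def stableNorm (ι : Γ →* H) (u : Γ →* Multiplicative ℝ) : ENNReal :=
  ⨆ (c : H1Real Γ) (_ : stableNormReal ι c ≤ 1), ENNReal.ofReal |pairing u c|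

end Deformation

end FlagAnosov

end

/-! The section of `E_{ρ_u}` is governed by a continuous function `f : H → ℝ` with periods `u`, that
is `f (ι γ h) = f h + u γ`: the map `h ↦ φ^{f h} ρ₀(h)` trivializes the flat bundle, and in this
gauge the flow acts by the diagonal matrices `φ^{-x} ρ₀(a^{-t})`, where `x` is the increment of `f`
along the orbit. The middle line of the constant frame is dominated on both sides exactly when
`|x| ≤ (1 - a) |t| + C` for some `a > 0`, and then the constant frame is an Anosov section.

Conversely, an Anosov section forces each orbit into one of three regimes, according to the order in
which the three lines grow: `f` varies at a rate less than `1`, or grows, or decreases, at a rate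
greater than `1`. The fast regimes are open and closed conditions, so they propagate along paths in
`H`; this is absurd because a quarter turn reverses the flow.

Finally, the increments of `f` have rate less than `1` if and only if `|u γ| ≤ κ t(γ)` for some
`κ < 1/2`, which says that the stable norm of `u` is less than `1/2`. One direction compares a long
orbit segment with a closed orbit, the other applies the Cartan decomposition to the powers of
`ι γ`. -/

noncomputable section

namespace FlagAnosov

open Filter Topology
open scoped Matrix
open Matrix.SpecialLinearGroup (toGL)

attribute [local instance] Matrix.linftyOpSeminormedAddCommGroup Matrix.linftyOpNormedRing
  Matrix.linftyOpNormedAlgebra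

/-! ### Topology of special linear groups and the diagonal flow -/

instance {n R : Type*} [Fintype n] [DecidableEq n] [CommRing R] [TopologicalSpace R]
    [IsTopologicalRing R] [T1Space R] [LocallyCompactSpace R] :
    LocallyCompactSpace (Matrix.SpecialLinearGroup n R) :=
  haveI : LocallyCompactSpace (Matrix n n R) := inferInstanceAs (LocallyCompactSpace (n → n → R))
  Matrix.SpecialLinearGroup.isClosedEmbedding_val.locallyCompactSpace

theorem continuous_aFlow : Continuous aFlow :=
  Continuous.subtype_mk (by fun_prop) _

theorem aFlow_add (s t : ℝ) : aFlow (s + t) = aFlow s * aFlow t := by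
  refine Subtype.ext ?_
  rw [Matrix.SpecialLinearGroup.coe_mul]
  ext i j
  fin_cases i <;> fin_cases j <;>
    simp [aFlow, Matrix.mul_apply, Fin.sum_univ_two, ← Real.exp_add, add_comm]

theorem aFlow_zero : aFlow 0 = 1 := by
  ext i j
  fin_cases i <;> fin_cases j <;> simp [aFlow]

theorem mul_aFlow_mul_aFlow_neg (h : H) (t : ℝ) : h * aFlow t * aFlow (-t) = h := by
  rw [mul_assoc, ← aFlow_add, add_neg_cancel, aFlow_zero, mul_one]

/-! ### Cocompact discrete subgroups -/

theorem isOpenMap_quotientMk {Γ X : Type*} [TopologicalSpace X] {s : Setoid X} {f : Γ → X → X}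
    (hf : ∀ γ, Continuous (f γ)) (hs : ∀ x y, s x y ↔ ∃ γ, y = f γ x) :
    IsOpenMap (Quotient.mk s) := by
  intro U hU
  have preimage_image : Quotient.mk s ⁻¹' (Quotient.mk s '' U) = ⋃ γ, f γ ⁻¹' U := by
    ext x
    simp only [Set.mem_preimage, Set.mem_image, Set.mem_iUnion]
    constructor
    · rintro ⟨y, hy, hyx⟩
      obtain ⟨γ, rfl⟩ := (hs x y).mp (s.symm (Quotient.exact hyx))
      exact ⟨γ, hy⟩
    · rintro ⟨γ, hγ⟩
      exact ⟨f γ x, hγ, Quotient.sound (s.symm ((hs x _).mpr ⟨γ, rfl⟩))⟩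
  rw [← (isQuotientMap_quotient_mk' (s := s)).isOpen_preimage]
  exact preimage_image ▸ isOpen_iUnion fun γ => hU.preimage (hf γ)

section Discrete

variable {Γ L : Type*} [Group Γ] [Group L] [TopologicalSpace L] [IsTopologicalGroup L]
  {ι : Γ →* L}

theorem finite_setOf_mul_mem [T2Space L] (hinj : Function.Injective ι)
    [DiscreteTopology ι.range] {K K' : Set L} (hK : IsCompact K) (hK' : IsCompact K') :
    {γ : Γ | ∃ h ∈ K, ι γ * h ∈ K'}.Finite := by
  have proper := ι.tendsto_coe_cofinite_of_discrete hinj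
    (isDiscrete_iff_discreteTopology.mpr inferInstance)
  have compact_quotients : IsCompact ((fun p : L × L => p.1 * p.2⁻¹) '' (K' ×ˢ K)) :=
    (hK'.prod hK).image (by fun_prop)
  have finite_inter := proper.eventually compact_quotients.compl_mem_cocompact
  rw [eventually_cofinite] at finite_inter
  refine finite_inter.subset ?_
  rintro γ ⟨h, hh, hγ⟩
  exact not_not.mpr ⟨(ι γ * h, h), ⟨hγ, hh⟩, by simp⟩

theorem exists_isOpen_forall_mul_mem_eq_one (hinj : Function.Injective ι)
    [DiscreteTopology ι.range] (h₀ : L) :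
    ∃ W : Set L, IsOpen W ∧ h₀ ∈ W ∧ ∀ γ : Γ, ∀ h ∈ W, ι γ * h ∈ W → γ = 1 := by
  obtain ⟨U, hU, preimage_U⟩ := isOpen_induced_iff.mp (isOpen_discrete ({1} : Set ι.range))
  have one_mem : (1 : L) ∈ U := (Set.ext_iff.mp preimage_U 1).mpr rfl
  have quotient_mem : ∀ᶠ p : L × L in 𝓝 h₀ ×ˢ 𝓝 h₀, p.1 * p.2⁻¹ ∈ U := by
    rw [← nhds_prod_eq]
    have quotient_continuous : ContinuousAt (fun p : L × L => p.1 * p.2⁻¹) (h₀, h₀) := by fun_prop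
    exact quotient_continuous.preimage_mem_nhds (hU.mem_nhds (by simpa using one_mem))
  obtain ⟨W', hW', mem_U⟩ := eventually_prod_self_iff'.mp quotient_mem
  obtain ⟨W, hWW', hW, hh₀⟩ := mem_nhds_iff.mp hW'
  refine ⟨W, hW, hh₀, fun γ h hh hγ => ?_⟩
  have hγU : ι γ ∈ U := by simpa using mem_U _ (hWW' hγ) _ (hWW' hh)
  have hγ1 : (⟨ι γ, γ, rfl⟩ : ι.range) = 1 := (Set.ext_iff.mp preimage_U ⟨ι γ, γ, rfl⟩).mp hγU
  exact hinj ((congrArg Subtype.val hγ1).trans (map_one ι).symm)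

end Discrete

section Lattice

variable {Γ : Type*} [Group Γ] {ι : Γ →* H}

theorem exists_isCompact_cover [CompactSpace (M ι)] :
    ∃ K : Set H, IsCompact K ∧ ∀ h : H, ∃ γ : Γ, ∃ k ∈ K, h = ι γ * k := by
  have isOpenMap_mk : IsOpenMap (Quotient.mk (orbitSetoid ι)) :=
    isOpenMap_quotientMk (f := fun γ h => ι γ * h) (fun γ => by fun_prop) fun _ _ => Iff.rfl
  choose C hC hC_nhds using fun h : H => exists_compact_mem_nhds h
  obtain ⟨t, -, ht⟩ := (isCompact_univ (X := M ι)).elim_nhds_subcover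
    (fun p => Quotient.mk (orbitSetoid ι) '' interior (C p.out)) fun p _ =>
      (isOpenMap_mk _ isOpen_interior).mem_nhds
        ⟨p.out, mem_interior_iff_mem_nhds.mpr (hC_nhds _), Quotient.out_eq p⟩
  refine ⟨⋃ p ∈ t, C p.out, t.isCompact_biUnion fun p _ => hC _, fun h => ?_⟩
  obtain ⟨p, hp, k, hk, hkh⟩ := Set.mem_iUnion₂.mp
    (ht (Set.mem_univ (Quotient.mk (orbitSetoid ι) h)))
  obtain ⟨γ, hγ⟩ := Quotient.exact hkh
  exact ⟨γ, k, Set.mem_iUnion₂.mpr ⟨p, hp, interior_subset hk⟩, hγ⟩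

theorem exists_norm_le_of_invariant [CompactSpace (M ι)] {X F : Type*} [TopologicalSpace X]
    [SeminormedAddCommGroup F] {f : H → X → F} (hf : Continuous (Function.uncurry f))
    (hinv : ∀ γ h, f (ι γ * h) = f h) {S : Set X} (hS : IsCompact S) :
    ∃ C > 0, ∀ h, ∀ x ∈ S, ‖f h x‖ ≤ C := by
  obtain ⟨K, hK, hcov⟩ := exists_isCompact_cover (ι := ι)
  obtain ⟨C, hC⟩ := (hK.prod hS).exists_bound_of_continuousOn hf.continuousOn
  refine ⟨max C 1, by positivity, fun h x hx => ?_⟩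
  obtain ⟨γ, k, hk, rfl⟩ := hcov h
  rw [hinv]
  exact (hC (k, x) ⟨hk, hx⟩).trans (le_max_left _ _)

/-- The function is the logarithm of `h ↦ ∑_γ e^{-u(γ)} ψ(ι(γ)h)`, where `ψ` is a bump function
equal to `1` on a compact set that meets every orbit. -/
theorem exists_continuous_equivariant (hinj : Function.Injective ι) [DiscreteTopology ι.range]
    [CompactSpace (M ι)] (u : Γ →* Multiplicative ℝ) :
    ∃ f : H → ℝ, Continuous f ∧ ∀ γ h, f (ι γ * h) = f h + (u γ).toAdd := by
  obtain ⟨K, hK, hcov⟩ := exists_isCompact_cover (ι := ι)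
  obtain ⟨ψ, hψ_one, -, hψ_compact, hψ_mem⟩ :=
    exists_continuous_one_zero_of_isCompact hK isClosed_empty (Set.disjoint_empty K)
  set F : Γ → H → ℝ := fun γ h => Real.exp (-(u γ).toAdd) * ψ (ι γ * h) with hF
  have F_nonneg : ∀ γ h, 0 ≤ F γ h := fun γ h => mul_nonneg (Real.exp_pos _).le (hψ_mem _).1
  have locallyFinite : LocallyFinite fun γ => Function.support (F γ) := by
    intro h
    obtain ⟨C, hC, hCh⟩ := exists_compact_mem_nhds h
    refine ⟨C, hCh, (finite_setOf_mul_mem hinj hC hψ_compact).subset ?_⟩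
    rintro γ ⟨h', hFh', hh'⟩
    exact ⟨h', hh', subset_tsupport _ (right_ne_zero_of_mul hFh')⟩
  have sum_continuous : Continuous fun h => ∑ᶠ γ, F γ h :=
    continuous_finsum (fun γ => by simp only [hF]; fun_prop) locallyFinite
  have sum_pos : ∀ h, 0 < ∑ᶠ γ, F γ h := by
    intro h
    obtain ⟨γ, k, hk, rfl⟩ := hcov h
    refine finsum_pos (fun γ => F_nonneg γ _) ⟨γ⁻¹, ?_⟩ (locallyFinite.point_finite _)
    simp [hF, hψ_one hk, Real.exp_pos]
  have sum_equivariant : ∀ δ h,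
      ∑ᶠ γ, F γ (ι δ * h) = Real.exp (u δ).toAdd * ∑ᶠ γ, F γ h := by
    intro δ h
    rw [mul_finsum, ← finsum_comp_equiv (Equiv.mulRight δ)
      (f := fun γ => Real.exp (u δ).toAdd * F γ h)]
    refine finsum_congr fun γ => ?_
    simp only [hF, Equiv.coe_mulRight, map_mul, toAdd_mul]
    rw [mul_assoc (ι γ), ← mul_assoc (Real.exp _), ← Real.exp_add]
    congr 2
    ring
  refine ⟨fun h => Real.log (∑ᶠ γ, F γ h), sum_continuous.log fun h => (sum_pos h).ne',
    fun δ h => ?_⟩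
  simp only [sum_equivariant]
  rw [Real.log_mul (Real.exp_pos _).ne' (sum_pos h).ne', Real.log_exp, add_comm]

end Lattice

/-! ### Spectral radii in `SL(2,ℝ)` -/

theorem linfty_opNorm_le_iff {m n α : Type*} [Fintype m] [Fintype n] [SeminormedAddCommGroup α]
    {A : Matrix m n α} {r : ℝ} (hr : 0 ≤ r) : ‖A‖ ≤ r ↔ ∀ i, ∑ j, ‖A i j‖ ≤ r := by
  lift r to NNReal using hr
  rw [Matrix.linfty_opNorm_def, NNReal.coe_le_coe, Finset.sup_le_iff]
  simp only [Finset.mem_univ, true_implies, ← NNReal.coe_le_coe, NNReal.coe_sum, coe_nnnorm]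

theorem norm_entry_le_linfty_opNorm {m n α : Type*} [Fintype m] [Fintype n]
    [SeminormedAddCommGroup α] (A : Matrix m n α) (i : m) (j : n) : ‖A i j‖ ≤ ‖A‖ :=
  (Finset.single_le_sum (f := fun j => ‖A i j‖) (fun _ _ => norm_nonneg _)
    (Finset.mem_univ j)).trans ((linfty_opNorm_le_iff (norm_nonneg A)).mp le_rfl i)

theorem spectralRadius_pow {A : Type*} [NormedRing A] [NormedAlgebra ℂ A] [CompleteSpace A]
    [Nontrivial A] (a : A) (n : ℕ) : spectralRadius ℂ (a ^ n) = spectralRadius ℂ a ^ n := by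
  refine le_antisymm (iSup₂_le fun k hk => ?_) (spectrum.spectralRadius_pow_le' a n)
  rw [spectrum.map_pow] at hk
  obtain ⟨l, hl, rfl⟩ := hk
  rw [nnnorm_pow, ENNReal.coe_pow]
  gcongr
  exact le_iSup₂ (f := fun k (_ : k ∈ spectrum ℂ a) => (‖k‖₊ : ENNReal)) l hl

theorem mem_spectrum_fin_two_iff {K : Type*} [Field K] {A : Matrix (Fin 2) (Fin 2) K} {k : K} :
    k ∈ spectrum K A ↔ k ^ 2 - A.trace * k + A.det = 0 := by
  rw [Matrix.mem_spectrum_iff_isRoot_charpoly, Matrix.charpoly_fin_two, Polynomial.IsRoot.def]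
  simp

/-- A vector `(x, y)` that is not an eigenvector of `A` spans the plane together with its image;
in this basis `A` becomes its companion matrix, and `ε` records the orientation of the basis. -/
theorem exists_conj_eq_companion {A : H} (hA : ¬(A 0 1 = 0 ∧ A 1 0 = 0)) :
    ∃ (h : H) (ε : ℝ), |ε| = 1 ∧ (h⁻¹ * A * h).1 = !![0, -ε; ε, A.1.trace] := by
  have det_eq : A 0 0 * A 1 1 - A 0 1 * A 1 0 = 1 := by
    rw [← Matrix.det_fin_two]; exact A.2
  obtain ⟨x, y, q, hq, q_ne_zero⟩ : ∃ x y q : ℝ,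
      q = x * (A 1 0 * x + A 1 1 * y) - y * (A 0 0 * x + A 0 1 * y) ∧ q ≠ 0 := by
    by_cases hA10 : A 1 0 = 0
    · exact ⟨0, 1, -A 0 1, by ring, fun hA01 => hA ⟨neg_eq_zero.mp hA01, hA10⟩⟩
    · exact ⟨1, 0, A 1 0, by ring, hA10⟩
  obtain ⟨ε, abs_ε, hεq⟩ : ∃ ε : ℝ, |ε| = 1 ∧ ε * q = |q| := by
    refine ⟨SignType.sign q, ?_, sign_mul_self q⟩
    rcases lt_or_gt_of_ne q_ne_zero with hq | hq <;> simp [hq]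
  have ε_mul_ε : ε * ε = 1 := by rw [← abs_mul_abs_self, abs_ε, one_mul]
  set s : ℝ := (Real.sqrt |q|)⁻¹
  have s_mul_s : s * s * (ε * q) = 1 := by
    rw [hεq, ← mul_inv, Real.mul_self_sqrt (abs_nonneg q),
      inv_mul_cancel₀ (abs_ne_zero.mpr q_ne_zero)]
  let h : H := ⟨!![s * x, ε * s * (A 0 0 * x + A 0 1 * y);
      s * y, ε * s * (A 1 0 * x + A 1 1 * y)], by
    rw [Matrix.det_fin_two_of]; linear_combination s_mul_s - s * s * ε * hq⟩
  let T : H := ⟨!![0, -ε; ε, A.1.trace], by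
    rw [Matrix.det_fin_two_of]; linear_combination ε_mul_ε⟩
  have A_mul_h : A * h = h * T := by
    ext i j
    rw [Matrix.SpecialLinearGroup.coe_mul, Matrix.SpecialLinearGroup.coe_mul]
    fin_cases i <;> fin_cases j <;>
      simp [h, T, Matrix.mul_apply, Fin.sum_univ_two, Matrix.trace_fin_two]
    · linear_combination (-s * (A 0 0 * x + A 0 1 * y)) * ε_mul_ε
    · linear_combination (-ε * s * x) * det_eq
    · linear_combination (-s * (A 1 0 * x + A 1 1 * y)) * ε_mul_ε
    · linear_combination (-ε * s * y) * det_eq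
  exact ⟨h, ε, abs_ε, by rw [mul_assoc, A_mul_h, inv_mul_cancel_left]⟩

theorem exists_conj_norm_le (A : H) : ∃ h : H, ‖(h⁻¹ * A * h).1‖ ≤ |A.1.trace| + 1 := by
  by_cases hdiag : A 0 1 = 0 ∧ A 1 0 = 0
  · obtain ⟨hA01, hA10⟩ := hdiag
    have diag_mul_pos : 0 < A 0 0 * A 1 1 := by
      have det_eq := A.2
      rw [Matrix.det_fin_two, hA01, zero_mul, sub_zero] at det_eq
      linarith
    have abs_trace : |A.1.trace| = |A 0 0| + |A 1 1| := by
      rw [Matrix.trace_fin_two, abs_add_eq_add_abs_iff]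
      exact (mul_pos_iff.mp diag_mul_pos).imp (fun h => ⟨h.1.le, h.2.le⟩) fun h => ⟨h.1.le, h.2.le⟩
    refine ⟨1, ?_⟩
    rw [inv_one, one_mul, mul_one, linfty_opNorm_le_iff (by positivity), abs_trace,
      Fin.forall_fin_two]
    simp only [Fin.sum_univ_two, hA01, hA10, Real.norm_eq_abs, abs_zero]
    constructor <;> linarith [abs_nonneg (A 0 0), abs_nonneg (A 1 1)]
  · obtain ⟨h, ε, abs_ε, hconj⟩ := exists_conj_eq_companion hdiag
    refine ⟨h, ?_⟩
    rw [hconj, linfty_opNorm_le_iff (by positivity), Fin.forall_fin_two]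
    simp [Fin.sum_univ_two, abs_ε, add_comm]

section Lattice

variable {Γ : Type*} [Group Γ] {ι : Γ →* H}

theorem exists_norm_eq_specRadius (γ : Γ) :
    ∃ k : ℂ, k ≠ 0 ∧ specRadius ι γ = ‖k‖ ∧ 1 ≤ ‖k‖ ∧ ((ι γ).1.trace : ℂ) = k + k⁻¹ := by
  set A : Matrix (Fin 2) (Fin 2) ℂ := (ι γ).1.map Complex.ofReal
  have trace_A : A.trace = ((ι γ).1.trace : ℂ) :=
    (AddMonoidHom.map_trace Complex.ofRealHom (ι γ).1).symm
  have det_A : A.det = 1 := by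
    have map_det := (RingHom.map_det Complex.ofRealHom (ι γ).1).symm
    rwa [(ι γ).2, map_one] at map_det
  obtain ⟨k, k_mem, norm_k⟩ := spectrum.exists_nnnorm_eq_spectralRadius A
  have root_k := mem_spectrum_fin_two_iff.mp k_mem
  rw [det_A, trace_A] at root_k
  have k_ne_zero : k ≠ 0 := by rintro rfl; simp at root_k
  have inv_mem : k⁻¹ ∈ spectrum ℂ A := by
    rw [mem_spectrum_fin_two_iff, det_A, trace_A]
    field_simp
    linear_combination root_k
  have norm_inv_le : ‖k‖⁻¹ ≤ ‖k‖ := by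
    rw [← norm_inv, ← coe_nnnorm, ← coe_nnnorm, NNReal.coe_le_coe, ← ENNReal.coe_le_coe, norm_k]
    exact le_iSup₂ (f := fun l (_ : l ∈ spectrum ℂ A) => (‖l‖₊ : ENNReal)) k⁻¹ inv_mem
  refine ⟨k, k_ne_zero, ?_, ?_, ?_⟩
  · rw [specRadius, ← norm_k, ENNReal.coe_toReal, coe_nnnorm]
  · by_contra! norm_lt
    exact (norm_inv_le.trans_lt norm_lt).not_gt
      ((one_lt_inv₀ (norm_pos_iff.mpr k_ne_zero)).mpr norm_lt)
  · field_simp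
    linear_combination -root_k

theorem one_le_specRadius (γ : Γ) : 1 ≤ specRadius ι γ := by
  obtain ⟨k, -, hk, one_le, -⟩ := exists_norm_eq_specRadius (ι := ι) γ
  exact hk ▸ one_le

theorem abs_trace_le_specRadius (γ : Γ) : |(ι γ).1.trace| ≤ 2 * specRadius ι γ := by
  obtain ⟨k, -, hk, one_le, trace_eq⟩ := exists_norm_eq_specRadius (ι := ι) γ
  rw [← Real.norm_eq_abs, ← Complex.norm_real, trace_eq, hk, two_mul]
  refine (norm_add_le _ _).trans (add_le_add_right ?_ _)
  rw [norm_inv]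
  exact (inv_le_one_of_one_le₀ one_le).trans one_le

theorem specRadius_le_norm (γ : Γ) : specRadius ι γ ≤ ‖(ι γ).1‖ := by
  refine ENNReal.toReal_le_of_le_ofReal (norm_nonneg _) ?_
  refine (spectrum.spectralRadius_le_nnnorm _).trans_eq ?_
  rw [ofReal_norm, enorm_eq_nnnorm, Matrix.linfty_opNNNorm_def, Matrix.linfty_opNNNorm_def]
  simp only [Matrix.map_apply, Complex.nnnorm_real]

theorem specRadius_pow (γ : Γ) (n : ℕ) : specRadius ι (γ ^ n) = specRadius ι γ ^ n := by
  rw [specRadius, specRadius, ← ENNReal.toReal_pow, ← spectralRadius_pow, map_pow,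
    Matrix.SpecialLinearGroup.coe_pow]
  exact congrArg (fun A => (spectralRadius ℂ A).toReal) (map_pow Complex.ofRealHom.mapMatrix _ n)

theorem exists_conj_norm_le_specRadius [CompactSpace (M ι)] :
    ∃ C : ℝ, 1 ≤ C ∧ ∀ γ : Γ, ∃ δ : Γ, ‖(ι (δ⁻¹ * γ * δ)).1‖ ≤ C * specRadius ι γ := by
  obtain ⟨K, hK, hcov⟩ := exists_isCompact_cover (ι := ι)
  obtain ⟨B, hB⟩ := hK.exists_bound_of_continuousOn
    (f := fun k : H => ‖k.1‖ * ‖k⁻¹.1‖) (by fun_prop)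
  refine ⟨max 1 (3 * B), le_max_left _ _, fun γ => ?_⟩
  obtain ⟨h, hh⟩ := exists_conj_norm_le (ι γ)
  obtain ⟨δ, k, hk, hδ⟩ := hcov h
  have conj_eq : ι (δ⁻¹ * γ * δ) = k * (h⁻¹ * ι γ * h) * k⁻¹ := by rw [hδ]; simp [mul_assoc]
  have specRadius_bound : ‖(h⁻¹ * ι γ * h).1‖ ≤ 3 * specRadius ι γ := by
    linarith [abs_trace_le_specRadius (ι := ι) γ, one_le_specRadius (ι := ι) γ]
  have hkB : ‖k.1‖ * ‖k⁻¹.1‖ ≤ B := (le_abs_self _).trans (hB k hk)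
  refine ⟨δ, ?_⟩
  calc ‖(ι (δ⁻¹ * γ * δ)).1‖
      ≤ ‖k.1‖ * ‖(h⁻¹ * ι γ * h).1‖ * ‖k⁻¹.1‖ := by
        rw [conj_eq, Matrix.SpecialLinearGroup.coe_mul, Matrix.SpecialLinearGroup.coe_mul k]
        exact norm_mul₃_le
    _ = ‖k.1‖ * ‖k⁻¹.1‖ * ‖(h⁻¹ * ι γ * h).1‖ := by ring
    _ ≤ B * (3 * specRadius ι γ) := mul_le_mul hkB specRadius_bound (norm_nonneg _)
        ((by positivity : (0 : ℝ) ≤ ‖k.1‖ * ‖k⁻¹.1‖).trans hkB)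
    _ = 3 * B * specRadius ι γ := by ring
    _ ≤ max 1 (3 * B) * specRadius ι γ := mul_le_mul_of_nonneg_right (le_max_right _ _)
        (zero_le_one.trans (one_le_specRadius γ))

theorem transLength_nonneg (γ : Γ) : 0 ≤ transLength ι γ :=
  mul_nonneg zero_le_two (Real.log_nonneg (one_le_specRadius γ))

theorem transLength_pow (γ : Γ) (n : ℕ) : transLength ι (γ ^ n) = n * transLength ι γ := by
  rw [transLength, specRadius_pow, Real.log_pow, transLength]
  ring

theorem exists_transLength_conj_mul_conj_le [CompactSpace (M ι)] :
    ∃ C : ℝ, ∀ γ γ' : Γ, ∃ δ δ' : Γ, transLength ι ((δ⁻¹ * γ * δ) * (δ'⁻¹ * γ' * δ')) ≤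
      transLength ι γ + transLength ι γ' + C := by
  obtain ⟨C, one_le_C, hC⟩ := exists_conj_norm_le_specRadius (ι := ι)
  refine ⟨2 * Real.log (C * C), fun γ γ' => ?_⟩
  obtain ⟨δ, hδ⟩ := hC γ
  obtain ⟨δ', hδ'⟩ := hC γ'
  refine ⟨δ, δ', ?_⟩
  have r_pos : ∀ γ, 0 < specRadius ι γ := fun γ => one_pos.trans_le (one_le_specRadius γ)
  have specRadius_le : specRadius ι ((δ⁻¹ * γ * δ) * (δ'⁻¹ * γ' * δ')) ≤
      specRadius ι γ * specRadius ι γ' * (C * C) :=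
    calc specRadius ι ((δ⁻¹ * γ * δ) * (δ'⁻¹ * γ' * δ'))
        ≤ ‖(ι (δ⁻¹ * γ * δ)).1‖ * ‖(ι (δ'⁻¹ * γ' * δ')).1‖ := by
          refine (specRadius_le_norm _).trans ?_
          rw [map_mul ι, Matrix.SpecialLinearGroup.coe_mul]
          exact norm_mul_le _ _
      _ ≤ C * specRadius ι γ * (C * specRadius ι γ') :=
          mul_le_mul hδ hδ' (norm_nonneg _) (mul_nonneg (by positivity) (r_pos γ).le)
      _ = specRadius ι γ * specRadius ι γ' * (C * C) := by ring
  have log_le := Real.log_le_log (r_pos _) specRadius_le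
  rw [Real.log_mul (mul_pos (r_pos _) (r_pos _)).ne' (by positivity),
    Real.log_mul (r_pos _).ne' (r_pos _).ne'] at log_le
  simp only [transLength]
  linarith

end Lattice

/-! ### The stable norm and periods -/

section StableNorm

variable {Γ : Type*} [Group Γ] {ι : Γ →* H}

theorem exists_of_eq (c : H1Int Γ) : ∃ γ : Γ, Additive.ofMul (Abelianization.of γ) = c := by
  obtain ⟨γ, hγ⟩ := QuotientGroup.mk_surjective c.toMul
  exact ⟨γ, congrArg Additive.ofMul hγ⟩

theorem classLength_nonneg (n : ℕ) (c : H1Int Γ) : 0 ≤ classLength ι n c := by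
  refine Real.sInf_nonneg ?_
  rintro x ⟨γ, -, rfl⟩
  exact div_nonneg (transLength_nonneg γ) n.cast_nonneg

theorem classLength_le {n : ℕ} {c : H1Int Γ} {γ : Γ}
    (hγ : Additive.ofMul (Abelianization.of γ) = n • c) :
    classLength ι n c ≤ transLength ι γ / n := by
  refine csInf_le ⟨0, ?_⟩ ⟨γ, hγ, rfl⟩
  rintro x ⟨γ', -, rfl⟩
  exact div_nonneg (transLength_nonneg γ') n.cast_nonneg

theorem exists_transLength_lt {n : ℕ} (hn : 0 < n) (c : H1Int Γ) {ε : ℝ} (hε : 0 < ε) :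
    ∃ γ : Γ, Additive.ofMul (Abelianization.of γ) = n • c ∧
      transLength ι γ < n * classLength ι n c + ε := by
  have hn' : (0 : ℝ) < n := Nat.cast_pos.mpr hn
  obtain ⟨γ₀, hγ₀⟩ := exists_of_eq (n • c)
  obtain ⟨_, ⟨γ, hγ, rfl⟩, hlt⟩ := Real.lt_sInf_add_pos
    (s := {x | ∃ γ : Γ, Additive.ofMul (Abelianization.of γ) = n • c ∧ x = transLength ι γ / n})
    ⟨_, γ₀, hγ₀, rfl⟩ (div_pos hε hn')
  change transLength ι γ / n < classLength ι n c + ε / n at hlt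
  refine ⟨γ, hγ, ?_⟩
  rwa [div_lt_iff₀ hn', add_mul, div_mul_cancel₀ _ hn'.ne', mul_comm _ (n : ℝ)] at hlt

variable {u : Γ →* Multiplicative ℝ} {κ : ℝ}

theorem abs_le_mul_classLength (hκ : 0 < κ) (hu : ∀ γ, |(u γ).toAdd| ≤ κ * transLength ι γ)
    {n : ℕ} (hn : 0 < n) (γ : Γ) :
    |(u γ).toAdd| ≤ κ * classLength ι n (Additive.ofMul (Abelianization.of γ)) := by
  have hn' : (0 : ℝ) < n := Nat.cast_pos.mpr hn
  rw [← div_le_iff₀' hκ]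
  refine le_csInf ⟨_, γ ^ n, by rw [map_pow, ofMul_pow], rfl⟩ ?_
  rintro _ ⟨δ, hδ, rfl⟩
  have u_δ : u δ = u γ ^ n := by
    have lift_eq := congrArg (fun c => Abelianization.lift u c.toMul) hδ
    simpa only [toMul_ofMul, toMul_nsmul, map_pow, Abelianization.lift_apply_of] using lift_eq
  have mul_le := hu δ
  rw [u_δ, toAdd_pow, nsmul_eq_mul, abs_mul, Nat.abs_cast] at mul_le
  rw [div_le_div_iff₀ hκ hn']
  linarith

theorem pairing_tmul_of (a : ℝ) (γ : Γ) :
    pairing u (a ⊗ₜ[ℤ] Additive.ofMul (Abelianization.of γ)) = a * (u γ).toAdd := by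
  simp [pairing]

variable [CompactSpace (M ι)]

theorem exists_subadditive_classLength (c : H1Int Γ) :
    ∃ C : ℝ, Subadditive fun n : ℕ => n * classLength ι n c + C := by
  obtain ⟨C, hC⟩ := exists_transLength_conj_mul_conj_le (ι := ι)
  refine ⟨max C 0, fun m n => ?_⟩
  rcases Nat.eq_zero_or_pos m with rfl | hm
  · simp
  rcases Nat.eq_zero_or_pos n with rfl | hn
  · simp
  refine le_of_forall_pos_le_add fun ε hε => ?_
  obtain ⟨γ, hγ, γ_lt⟩ := exists_transLength_lt (ι := ι) hm c (half_pos hε)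
  obtain ⟨γ', hγ', γ'_lt⟩ := exists_transLength_lt (ι := ι) hn c (half_pos hε)
  obtain ⟨δ, δ', conj_le⟩ := hC γ γ'
  have of_conj : ∀ γ δ : Γ, Abelianization.of (δ⁻¹ * γ * δ) = Abelianization.of γ := by
    simp [mul_comm]
  have hle := classLength_le (ι := ι) (n := m + n) (c := c)
    (γ := (δ⁻¹ * γ * δ) * (δ'⁻¹ * γ' * δ')) (by
      rw [map_mul, of_conj, of_conj, ofMul_mul, hγ, hγ', add_smul])
  rw [le_div_iff₀' (Nat.cast_pos.mpr (by omega))] at hle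
  linarith [le_max_left C 0]

theorem tendsto_classLength (c : H1Int Γ) :
    Tendsto (fun n : ℕ => classLength ι n c) atTop (𝓝 (stableNormInt ι c)) := by
  obtain ⟨C, hC⟩ := exists_subadditive_classLength (ι := ι) c
  have bddBelow : BddBelow (Set.range fun n : ℕ => (n * classLength ι n c + C) / n) := by
    refine ⟨-|C|, ?_⟩
    rintro _ ⟨n, rfl⟩
    rcases Nat.eq_zero_or_pos n with rfl | hn
    · simp
    · have one_le : (1 : ℝ) ≤ n := by exact_mod_cast hn
      have hnonneg := mul_nonneg n.cast_nonneg (classLength_nonneg (ι := ι) n c)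
      rw [le_div_iff₀ (by linarith)]
      nlinarith [neg_abs_le C, abs_nonneg C]
  have tendsto_sub := (hC.tendsto_lim bddBelow).sub (tendsto_const_div_atTop_nhds_zero_nat C)
  rw [sub_zero] at tendsto_sub
  refine tendsto_nhds_limUnder ⟨hC.lim, tendsto_sub.congr' ?_⟩
  filter_upwards [eventually_ne_atTop 0] with n hn
  field_simp
  ring

theorem stableNormInt_nonneg (c : H1Int Γ) : 0 ≤ stableNormInt ι c :=
  ge_of_tendsto' (tendsto_classLength c) fun n => classLength_nonneg n c

theorem stableNormInt_of_le_transLength (γ : Γ) :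
    stableNormInt ι (Additive.ofMul (Abelianization.of γ)) ≤ transLength ι γ := by
  refine le_of_tendsto (tendsto_classLength _) ?_
  filter_upwards [eventually_gt_atTop 0] with n hn
  refine (classLength_le (γ := γ ^ n) (by rw [map_pow, ofMul_pow])).trans_eq ?_
  rw [transLength_pow]
  field_simp

theorem stableNormReal_tmul_of_le (a : ℝ) (γ : Γ) :
    stableNormReal ι (a ⊗ₜ[ℤ] Additive.ofMul (Abelianization.of γ)) ≤ |a| * transLength ι γ := by
  calc stableNormReal ι (a ⊗ₜ[ℤ] Additive.ofMul (Abelianization.of γ))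
      ≤ |a| * stableNormInt ι (Additive.ofMul (Abelianization.of γ)) := by
        refine csInf_le ⟨0, ?_⟩ ⟨Finsupp.single _ a, Finsupp.sum_single_index (by simp),
          by rw [Finsupp.sum_single_index (by simp)]⟩
        rintro x ⟨l, -, rfl⟩
        exact Finset.sum_nonneg fun e _ => mul_nonneg (abs_nonneg _) (stableNormInt_nonneg e)
    _ ≤ |a| * transLength ι γ :=
        mul_le_mul_of_nonneg_left (stableNormInt_of_le_transLength γ) (abs_nonneg a)

theorem abs_pairing_le_mul_stableNormReal (hκ : 0 < κ)
    (hu : ∀ γ, |(u γ).toAdd| ≤ κ * transLength ι γ) (c : H1Real Γ) :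
    |pairing u c| ≤ κ * stableNormReal ι c := by
  have abs_pairing_tmul_le : ∀ (a : ℝ) (e : H1Int Γ),
      |pairing u (a ⊗ₜ[ℤ] e)| ≤ κ * (|a| * stableNormInt ι e) := by
    intro a e
    obtain ⟨γ, rfl⟩ := exists_of_eq e
    have abs_le := ge_of_tendsto ((tendsto_classLength _).const_mul κ)
      ((eventually_gt_atTop 0).mono fun n hn => abs_le_mul_classLength hκ hu hn γ)
    rw [pairing_tmul_of, abs_mul, mul_left_comm]
    exact mul_le_mul_of_nonneg_left abs_le (abs_nonneg a)
  rw [← div_le_iff₀' hκ]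
  obtain ⟨l, hl⟩ := TensorProduct.exists_finsupp_right c
  refine le_csInf ⟨_, l, hl.symm, rfl⟩ ?_
  rintro x ⟨l, rfl, rfl⟩
  rw [div_le_iff₀' hκ, Finsupp.sum, Finsupp.sum, map_sum, Finset.mul_sum]
  exact (Finset.abs_sum_le_sum_abs _ _).trans (Finset.sum_le_sum fun e _ => abs_pairing_tmul_le _ _)

theorem stableNorm_le_ofReal_iff (hκ : 0 < κ) :
    stableNorm ι u ≤ ENNReal.ofReal κ ↔ ∀ γ, |(u γ).toAdd| ≤ κ * transLength ι γ := by
  simp only [stableNorm, iSup_le_iff, ENNReal.ofReal_le_ofReal_iff hκ.le]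
  refine ⟨fun h γ => ?_, fun hu c hc => ?_⟩
  · refine le_of_forall_pos_le_add fun ε hε => ?_
    have denom_pos : 0 < transLength ι γ + ε / κ :=
      add_pos_of_nonneg_of_pos (transLength_nonneg γ) (div_pos hε hκ)
    have pairing_le := h ((transLength ι γ + ε / κ)⁻¹ ⊗ₜ[ℤ] Additive.ofMul (Abelianization.of γ))
      ((stableNormReal_tmul_of_le _ γ).trans (by
        rw [abs_of_pos (inv_pos.mpr denom_pos), inv_mul_le_one₀ denom_pos]
        exact le_add_of_nonneg_right (div_pos hε hκ).le))
    rwa [pairing_tmul_of, abs_mul, abs_of_pos (inv_pos.mpr denom_pos), inv_mul_le_iff₀ denom_pos,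
      add_mul, div_mul_cancel₀ _ hκ.ne', mul_comm _ κ] at pairing_le
  · exact (abs_pairing_le_mul_stableNormReal hκ hu c).trans (mul_le_of_le_one_right hκ.le hc)

theorem stableNorm_lt_ofReal_iff {r : ℝ} (hr : 0 < r) :
    stableNorm ι u < ENNReal.ofReal r ↔
      ∃ κ, 0 < κ ∧ κ < r ∧ ∀ γ, |(u γ).toAdd| ≤ κ * transLength ι γ := by
  refine ⟨fun hlt => ?_, fun ⟨κ, hκ, hκr, hu⟩ => ?_⟩
  · obtain ⟨κ, -, lt_κ, κ_lt⟩ := ENNReal.lt_iff_exists_real_btwn.mp hlt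
    have hκ : 0 < κ := ENNReal.ofReal_pos.mp (zero_le.trans_lt lt_κ)
    exact ⟨κ, hκ, (ENNReal.ofReal_lt_ofReal_iff hr).mp κ_lt,
      (stableNorm_le_ofReal_iff hκ).mp lt_κ.le⟩
  · exact ((stableNorm_le_ofReal_iff hκ).mpr hu).trans_lt
      ((ENNReal.ofReal_lt_ofReal_iff hr).mpr hκr)

end StableNorm

/-! ### Frames as classes of invertible matrices -/

theorem linearIndependent_col (F : GL (Fin 3) ℝ) : LinearIndependent ℝ F.1.col :=
  Matrix.linearIndependent_cols_iff_isUnit.mpr F.isUnit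

/-- The point of the frame variety given by an invertible matrix: the triple of the lines spanned
by its columns. -/
def frameOf (F : GL (Fin 3) ℝ) : Frame :=
  ⟨fun j => Projectivization.mk ℝ (F.1.col j) ((linearIndependent_col F).ne_zero j),
    Projectivization.Independent.mk _ _ (linearIndependent_col F)⟩

theorem frameOf_eq_frameOf_iff {F F' : GL (Fin 3) ℝ} :
    frameOf F = frameOf F' ↔ ∃ m : Fin 3 → ℝ, F.1 = F'.1 * Matrix.diagonal m := by
  simp only [frameOf, Subtype.mk.injEq, funext_iff, Projectivization.mk_eq_mk_iff',
    Matrix.col_apply, Pi.smul_apply, smul_eq_mul, ← Matrix.ext_iff, Matrix.mul_diagonal,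
    mul_comm (F'.1 _ _)]
  rw [Classical.skolem]
  exact exists_congr fun m => ⟨fun h i j => (h j i).symm, fun h j i => (h i j).symm⟩

theorem smul_frameOf (g : G) (F : GL (Fin 3) ℝ) : g • frameOf F = frameOf (g * F) :=
  Subtype.ext (funext fun _ => Projectivization.smul_mk g _)

theorem frameOf_surjective : Function.Surjective frameOf := fun y => by
  have hunit : IsUnit (Matrix.of fun j => (y.1 j).rep)ᵀ :=
    Matrix.linearIndependent_cols_iff_isUnit.mp (Projectivization.independent_iff.mp y.2)
  exact ⟨hunit.unit, Subtype.ext (funext fun j => (y.1 j).mk_rep)⟩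

theorem exists_frameOf_eq_and_norm_col_eq_one (y : Frame) :
    ∃ F : GL (Fin 3) ℝ, frameOf F = y ∧ ∀ j, ‖F.1.col j‖ = 1 := by
  obtain ⟨F, rfl⟩ := frameOf_surjective y
  have hcol : ∀ j, ‖F.1.col j‖ ≠ 0 := fun j =>
    norm_ne_zero_iff.mpr ((linearIndependent_col F).ne_zero j)
  have hdet : (F.1 * Matrix.diagonal fun j => ‖F.1.col j‖⁻¹).det ≠ 0 := by
    rw [Matrix.det_mul, Matrix.det_diagonal]
    exact mul_ne_zero (Matrix.GeneralLinearGroup.det_ne_zero F)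
      (Finset.prod_ne_zero_iff.mpr fun j _ => inv_ne_zero (hcol j))
  refine ⟨Matrix.GeneralLinearGroup.mkOfDetNeZero _ hdet, frameOf_eq_frameOf_iff.mpr ⟨_, rfl⟩,
    fun j => ?_⟩
  have hscale : (F.1 * Matrix.diagonal fun j => ‖F.1.col j‖⁻¹).col j =
      ‖F.1.col j‖⁻¹ • F.1.col j := by
    ext i
    simp [Matrix.mul_diagonal, mul_comm]
  change ‖(F.1 * Matrix.diagonal fun j => ‖F.1.col j‖⁻¹).col j‖ = 1
  rw [hscale, norm_smul, norm_inv, norm_norm, inv_mul_cancel₀ (hcol j)]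

theorem isOpenQuotientMap_projectivization_mk :
    IsOpenQuotientMap (Projectivization.mk' ℝ : {v : V // v ≠ 0} → ℙ ℝ V) := by
  refine ⟨Quotient.mk''_surjective, continuous_coinduced_rng, ?_⟩
  refine isOpenMap_quotientMk (s := projectivizationSetoid ℝ V)
    (f := fun (a : ℝˣ) v => ⟨a • v.1, (smul_ne_zero_iff_ne a).mpr v.2⟩) (fun a => by fun_prop)
    fun v w => ?_
  rw [Setoid.comm']
  exact exists_congr fun a => ⟨fun h => Subtype.ext h.symm, fun h => congrArg Subtype.val h.symm⟩

theorem continuous_frameOf : Continuous frameOf :=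
  Continuous.subtype_mk (continuous_pi fun j =>
    isOpenQuotientMap_projectivization_mk.continuous.comp
      ((continuous_pi fun i => Units.continuous_val.matrix_elem i j).subtype_mk
        fun F => (linearIndependent_col F).ne_zero j)) _

theorem isOpenMap_frameOf : IsOpenMap frameOf := by
  intro U hU
  have hpi : IsOpenQuotientMap
      fun (v : Fin 3 → {v : V // v ≠ 0}) j => Projectivization.mk' ℝ (v j) :=
    .piMap fun _ => isOpenQuotientMap_projectivization_mk
  have hmat : Continuous fun v : Fin 3 → {v : V // v ≠ 0} => (Matrix.of fun j => (v j).1)ᵀ :=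
    continuous_matrix fun i j => by fun_prop
  have himage : frameOf '' U = Subtype.val ⁻¹' ((fun v j => Projectivization.mk' ℝ (v j)) ''
      ((fun v : Fin 3 → {v : V // v ≠ 0} => (Matrix.of fun j => (v j).1)ᵀ) ⁻¹'
        (Units.val '' U))) := by
    ext y
    constructor
    · rintro ⟨F, hF, rfl⟩
      exact ⟨fun j => ⟨F.1.col j, (linearIndependent_col F).ne_zero j⟩, ⟨F, hF, rfl⟩, rfl⟩
    · rintro ⟨v, ⟨F, hF, hFv⟩, hvy⟩
      refine ⟨F, hF, Subtype.ext (hvy ▸ funext fun j => ?_)⟩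
      simp only [frameOf, hFv]
      rfl
  rw [himage]
  exact (hpi.isOpenMap _ ((Units.isOpenEmbedding_val.isOpenMap U hU).preimage hmat)).preimage
    continuous_subtype_val

theorem isOpenQuotientMap_frameOf : IsOpenQuotientMap frameOf :=
  ⟨frameOf_surjective, continuous_frameOf, isOpenMap_frameOf⟩

theorem continuous_smul_frame (g : G) : Continuous fun y : Frame => g • y := by
  refine isOpenQuotientMap_frameOf.continuous_comp_iff.mp ?_
  simp only [Function.comp_def, smul_frameOf]
  exact continuous_frameOf.comp (continuous_const.mul continuous_id)

/-! ### The stabilizers of a frame and of its flags -/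

theorem mem_span_col_iff (F : GL (Fin 3) ℝ) (S : Set (Fin 3)) (w : V) :
    w ∈ Submodule.span ℝ (F.1.col '' S) ↔ ∀ i ∉ S, ((F⁻¹).1 *ᵥ w) i = 0 := by
  constructor
  · intro hw i hi
    induction hw using Submodule.span_induction with
    | mem w hw =>
      obtain ⟨j, hj, rfl⟩ := hw
      rw [← Matrix.mulVec_single_one, Matrix.mulVec_mulVec, Units.inv_mul, Matrix.one_mulVec,
        Pi.single_eq_of_ne (ne_of_mem_of_not_mem hj hi).symm]
    | zero => simp
    | add v w _ _ hv hw => rw [Matrix.mulVec_add, Pi.add_apply, hv, hw, add_zero]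
    | smul c v _ hv => rw [Matrix.mulVec_smul, Pi.smul_apply, hv, smul_zero]
  · intro hw
    have hsum : w = ∑ j, ((F⁻¹).1 *ᵥ w) j • F.1.col j := by
      conv_lhs => rw [← Matrix.one_mulVec w, ← F.mul_inv, ← Matrix.mulVec_mulVec,
        Matrix.mulVec_eq_sum]
      simp
      rfl
    rw [hsum]
    refine Submodule.sum_mem _ fun j _ => ?_
    by_cases hj : j ∈ S
    · exact Submodule.smul_mem _ _ (Submodule.subset_span ⟨j, hj, rfl⟩)
    · rw [hw j hj, zero_smul]
      exact Submodule.zero_mem _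

theorem mem_preserving_span_col_iff (F : GL (Fin 3) ℝ) (S : Set (Fin 3))
    (ξ : Matrix (Fin 3) (Fin 3) ℝ) :
    ξ ∈ preserving (Submodule.span ℝ (F.1.col '' S)) ↔
      ∀ j ∈ S, ∀ i ∉ S, ((F⁻¹).1 * ξ * F.1) i j = 0 := by
  have hconj : ∀ j i, ((F⁻¹).1 * ξ * F.1) i j = ((F⁻¹).1 *ᵥ (ξ *ᵥ F.1.col j)) i := fun j i => by
    rw [← Matrix.mulVec_single_one, Matrix.mulVec_mulVec, Matrix.mulVec_mulVec,
      Matrix.mulVec_single_one, Matrix.col_apply]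
  simp only [hconj]
  calc ξ ∈ preserving (Submodule.span ℝ (F.1.col '' S))
      ↔ Submodule.span ℝ (F.1.col '' S) ≤
          (Submodule.span ℝ (F.1.col '' S)).comap ξ.mulVecLin := Iff.rfl
    _ ↔ _ := by
      rw [Submodule.span_le, Set.image_subset_iff]
      exact forall₂_congr fun j _ => mem_span_col_iff F S _

theorem submodule_frameOf (F : GL (Fin 3) ℝ) (j : Fin 3) :
    ((frameOf F).1 j).submodule = Submodule.span ℝ (F.1.col '' {j}) := by
  rw [Set.image_singleton]
  exact Projectivization.submodule_mk _ _

theorem submodule_frameOf_sup (F : GL (Fin 3) ℝ) (j k : Fin 3) :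
    ((frameOf F).1 j).submodule ⊔ ((frameOf F).1 k).submodule =
      Submodule.span ℝ (F.1.col '' {j, k}) := by
  rw [submodule_frameOf, submodule_frameOf, ← Submodule.span_union, ← Set.image_union,
    Set.singleton_union]

theorem mem_isotropy_frameOf_iff (F : GL (Fin 3) ℝ) (ξ : Matrix (Fin 3) (Fin 3) ℝ) :
    ξ ∈ isotropy (frameOf F) ↔ ∀ i j, i ≠ j → ((F⁻¹).1 * ξ * F.1) i j = 0 := by
  simp only [isotropy, Submodule.mem_iInf, submodule_frameOf, mem_preserving_span_col_iff,
    Set.mem_singleton_iff, forall_eq]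
  exact forall_comm

theorem mem_flagIsotropy_piPlus_frameOf_iff (F : GL (Fin 3) ℝ) (ξ : Matrix (Fin 3) (Fin 3) ℝ) :
    ξ ∈ flagIsotropy (piPlus (frameOf F)) ↔ ∀ i j, j < i → ((F⁻¹).1 * ξ * F.1) i j = 0 := by
  rw [flagIsotropy, piPlus, submodule_frameOf_sup, submodule_frameOf, Submodule.mem_inf,
    mem_preserving_span_col_iff, mem_preserving_span_col_iff]
  generalize (F⁻¹).1 * ξ * F.1 = X
  simp only [Fin.forall_fin_succ, Set.mem_insert_iff, Set.mem_singleton_iff]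
  grind

theorem mem_flagIsotropy_piMinus_frameOf_iff (F : GL (Fin 3) ℝ) (ξ : Matrix (Fin 3) (Fin 3) ℝ) :
    ξ ∈ flagIsotropy (piMinus (frameOf F)) ↔ ∀ i j, i < j → ((F⁻¹).1 * ξ * F.1) i j = 0 := by
  rw [flagIsotropy, piMinus, submodule_frameOf_sup, submodule_frameOf, Submodule.mem_inf,
    mem_preserving_span_col_iff, mem_preserving_span_col_iff]
  generalize (F⁻¹).1 * ξ * F.1 = X
  simp only [Fin.forall_fin_succ, Set.mem_insert_iff, Set.mem_singleton_iff]
  grind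

theorem mem_map_mkQ_isotropy_iff (F : GL (Fin 3) ℝ) {S : Submodule ℝ (Matrix (Fin 3) (Fin 3) ℝ)}
    {r : Fin 3 → Fin 3 → Prop}
    (hS : ∀ ξ, ξ ∈ S ↔ ∀ i j, r i j → ((F⁻¹).1 * ξ * F.1) i j = 0)
    (hr : ∀ i, ¬ r i i) (v : FrameTangent (frameOf F)) :
    v ∈ S.map (isotropy (frameOf F)).mkQ ↔ ∃ X : Matrix (Fin 3) (Fin 3) ℝ,
      (∀ i j, i = j ∨ r i j → X i j = 0) ∧
        (isotropy (frameOf F)).mkQ (F.1 * X * (F⁻¹).1) = v := by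
  have hconj : ∀ X : Matrix (Fin 3) (Fin 3) ℝ, (F⁻¹).1 * (F.1 * X * (F⁻¹).1) * F.1 = X := by
    intro X
    simp only [Matrix.mul_assoc, Units.inv_mul_cancel_left, Units.inv_mul, mul_one]
  constructor
  · rintro ⟨ξ, hξ, rfl⟩
    set X := (F⁻¹).1 * ξ * F.1 with hX
    refine ⟨X - Matrix.diagonal X.diag, fun i j hij => ?_, ?_⟩
    · rcases hij with rfl | hij
      · simp
      · have hne : i ≠ j := by rintro rfl; exact hr i hij
        have hzero : X i j = 0 := (hS ξ).mp hξ i j hij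
        rw [Matrix.sub_apply, hzero, Matrix.diagonal_apply_ne _ hne, sub_zero]
    · refine (Submodule.Quotient.eq _).mpr ((mem_isotropy_frameOf_iff F _).mpr fun i j hij => ?_)
      rw [Matrix.mul_sub, Matrix.sub_mul, hconj, ← hX]
      simp [hij]
  · rintro ⟨X, hX, rfl⟩
    exact ⟨_, (hS _).mpr fun i j hij => by rw [hconj]; exact hX i j (Or.inr hij), rfl⟩

theorem mem_EPlus_frameOf_iff (F : GL (Fin 3) ℝ) (v : FrameTangent (frameOf F)) :
    v ∈ EPlus (frameOf F) ↔ ∃ X : Matrix (Fin 3) (Fin 3) ℝ, (∀ i j, j ≤ i → X i j = 0) ∧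
      (isotropy (frameOf F)).mkQ (F.1 * X * (F⁻¹).1) = v := by
  simp only [le_iff_eq_or_lt, eq_comm (b := (_ : Fin 3))]
  exact mem_map_mkQ_isotropy_iff F (mem_flagIsotropy_piPlus_frameOf_iff F) (fun i => lt_irrefl i) v

theorem mem_EMinus_frameOf_iff (F : GL (Fin 3) ℝ) (v : FrameTangent (frameOf F)) :
    v ∈ EMinus (frameOf F) ↔ ∃ X : Matrix (Fin 3) (Fin 3) ℝ, (∀ i j, i ≤ j → X i j = 0) ∧
      (isotropy (frameOf F)).mkQ (F.1 * X * (F⁻¹).1) = v := by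
  simp only [le_iff_eq_or_lt]
  exact mem_map_mkQ_isotropy_iff F (mem_flagIsotropy_piMinus_frameOf_iff F) (fun i => lt_irrefl i) v

/-! ### Projectors of a frame -/

theorem inv_val_mul_val (g : G) : (g⁻¹).1 * g.1 = 1 :=
  congrArg Subtype.val (inv_mul_cancel g)

theorem continuous_inv_val {n : Type*} [Fintype n] [DecidableEq n] :
    Continuous fun g : Matrix.SpecialLinearGroup n ℝ => (g⁻¹).1 :=
  continuous_subtype_val.comp (continuous_inv (G := Matrix.SpecialLinearGroup n ℝ))

/-- The projector of `ℝ³` onto the `j`-th line of the frame `y` along its other two lines. -/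
def lineProj (y : Frame) (j : Fin 3) : Matrix (Fin 3) (Fin 3) ℝ :=
  (Function.surjInv frameOf_surjective y).1 * Matrix.single j j 1 *
    (Function.surjInv frameOf_surjective y)⁻¹.1

theorem lineProj_frameOf (F : GL (Fin 3) ℝ) (j : Fin 3) :
    lineProj (frameOf F) j = F.1 * Matrix.single j j 1 * (F⁻¹).1 := by
  obtain ⟨m, hm⟩ := frameOf_eq_frameOf_iff.mp (Function.surjInv_eq frameOf_surjective (frameOf F))
  rw [lineProj, Units.mul_inv_eq_iff_eq_mul, hm, Matrix.mul_assoc _ (F⁻¹).1,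
    Units.inv_mul_cancel_left, Matrix.mul_assoc, Matrix.mul_assoc, ← Matrix.diagonal_single,
    (Matrix.commute_diagonal m _).eq]

theorem continuous_lineProj (j : Fin 3) : Continuous fun y => lineProj y j := by
  refine isOpenQuotientMap_frameOf.continuous_comp_iff.mp ?_
  simp only [Function.comp_def, lineProj_frameOf]
  exact (Units.continuous_val.mul continuous_const).mul
    (Units.continuous_val.comp continuous_inv)

theorem lineProj_smul (g : G) (y : Frame) (j : Fin 3) :
    lineProj (g • y) j = g.1 * lineProj y j * (g⁻¹).1 := by
  obtain ⟨F, rfl⟩ := frameOf_surjective y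
  rw [smul_frameOf, lineProj_frameOf, lineProj_frameOf, mul_inv_rev, Units.val_mul, Units.val_mul]
  simp only [Matrix.mul_assoc]
  rfl

theorem one_le_norm_lineProj (y : Frame) (j : Fin 3) : 1 ≤ ‖lineProj y j‖ := by
  obtain ⟨F, rfl⟩ := frameOf_surjective y
  have hne : lineProj (frameOf F) j ≠ 0 := fun h => by
    rw [lineProj_frameOf, Units.mul_left_eq_zero, Units.mul_right_eq_zero] at h
    simpa using congrFun₂ h j j
  have hidem : lineProj (frameOf F) j * lineProj (frameOf F) j = lineProj (frameOf F) j := by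
    simp only [lineProj_frameOf, Matrix.mul_assoc, Units.inv_mul_cancel_left]
    rw [← Matrix.mul_assoc (Matrix.single j j 1), Matrix.single_mul_single_same, one_mul]
  have hle := norm_mul_le (lineProj (frameOf F) j) (lineProj (frameOf F) j)
  rw [hidem] at hle
  exact le_of_mul_le_mul_right (by simpa using hle) (norm_pos_iff.mpr hne)

/-- The part of an endomorphism that is off-diagonal with respect to the lines of the frame `y`.
Its kernel is `isotropy y`, hence it identifies the tangent space `T_y Y` with a space of
matrices. -/
def offDiagPart (y : Frame) : Matrix (Fin 3) (Fin 3) ℝ →ₗ[ℝ] Matrix (Fin 3) (Fin 3) ℝ :=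
  LinearMap.id - ∑ j, LinearMap.mulLeftRight ℝ (lineProj y j, lineProj y j)

theorem offDiagPart_apply (y : Frame) (ξ : Matrix (Fin 3) (Fin 3) ℝ) :
    offDiagPart y ξ = ξ - ∑ j, lineProj y j * ξ * lineProj y j := by
  simp [offDiagPart]

theorem continuous_offDiagPart :
    Continuous fun p : Frame × Matrix (Fin 3) (Fin 3) ℝ => offDiagPart p.1 p.2 := by
  simp only [offDiagPart_apply]
  refine continuous_snd.sub (continuous_finsetSum _ fun j _ => ?_)
  have hproj := (continuous_lineProj j).comp
    (continuous_fst (X := Frame) (Y := Matrix (Fin 3) (Fin 3) ℝ))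
  exact (hproj.mul continuous_snd).mul hproj

theorem offDiagPart_smul (g : G) (y : Frame) (ξ : Matrix (Fin 3) (Fin 3) ℝ) :
    offDiagPart (g • y) (g.1 * ξ * (g⁻¹).1) = g.1 * offDiagPart y ξ * (g⁻¹).1 := by
  have hcancel : ∀ X : Matrix (Fin 3) (Fin 3) ℝ, (g⁻¹).1 * (g.1 * X) = X := fun X => by
    rw [← Matrix.mul_assoc, inv_val_mul_val, Matrix.one_mul]
  simp only [offDiagPart_apply, lineProj_smul, Matrix.mul_sub, Matrix.sub_mul, Finset.mul_sum,
    Finset.sum_mul, Matrix.mul_assoc, hcancel]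

theorem offDiagPart_frameOf_conj (F : GL (Fin 3) ℝ) (X : Matrix (Fin 3) (Fin 3) ℝ) :
    offDiagPart (frameOf F) (F.1 * X * (F⁻¹).1) =
      F.1 * (X - Matrix.diagonal X.diag) * (F⁻¹).1 := by
  have hdiag : Matrix.diagonal X.diag =
      ∑ k, Matrix.single k k 1 * X * Matrix.single k k 1 := by
    simp only [Matrix.single_mul_mul_single, one_mul, mul_one, ← Matrix.sum_single_eq_diagonal,
      Matrix.diag_apply]
  simp only [offDiagPart_apply, lineProj_frameOf, hdiag, Matrix.mul_sub, Matrix.sub_mul,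
    Finset.mul_sum, Finset.sum_mul, Matrix.mul_assoc, Units.inv_mul_cancel_left]

theorem ker_offDiagPart (y : Frame) : LinearMap.ker (offDiagPart y) = isotropy y := by
  obtain ⟨F, rfl⟩ := frameOf_surjective y
  ext ξ
  rw [LinearMap.mem_ker, mem_isotropy_frameOf_iff]
  have hξ : ξ = F.1 * ((F⁻¹).1 * ξ * F.1) * (F⁻¹).1 := by
    simp only [Matrix.mul_assoc, Units.mul_inv_cancel_left, Units.mul_inv, mul_one]
  conv_lhs => rw [hξ, offDiagPart_frameOf_conj, Units.mul_left_eq_zero, Units.mul_right_eq_zero,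
    sub_eq_zero, eq_comm]
  exact Matrix.isDiag_iff_diagonal_diag _ |>.symm

/-- The norm `‖g⁻¹ ξ g‖` of the off-diagonal representative `ξ` of a tangent vector at `y`. -/
def conjSeminorm (g : G) (y : Frame) : Seminorm ℝ (FrameTangent y) :=
  (normSeminorm ℝ (Matrix (Fin 3) (Fin 3) ℝ)).comp
    (LinearMap.mulLeftRight ℝ ((g⁻¹).1, g.1) ∘ₗ
      (isotropy y).liftQ (offDiagPart y) (ker_offDiagPart y).ge)

theorem conjSeminorm_mkQ (g : G) (y : Frame) (ξ : Matrix (Fin 3) (Fin 3) ℝ) :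
    conjSeminorm g y ((isotropy y).mkQ ξ) = ‖(g⁻¹).1 * offDiagPart y ξ * g.1‖ :=
  rfl

theorem conjSeminorm_definite (g : G) (y : Frame) (v : FrameTangent y)
    (hv : conjSeminorm g y v = 0) : v = 0 := by
  obtain ⟨ξ, rfl⟩ := (isotropy y).mkQ_surjective v
  have hzero : (toGL g)⁻¹.1 * offDiagPart y ξ * (toGL g).1 = 0 := norm_eq_zero.mp hv
  rw [Units.mul_left_eq_zero, Units.mul_right_eq_zero, ← LinearMap.mem_ker,
    ker_offDiagPart] at hzero
  exact (Submodule.Quotient.mk_eq_zero _).mpr hzero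

theorem conjSeminorm_mul_smul (g g' : G) (y : Frame) (ξ : Matrix (Fin 3) (Fin 3) ℝ) :
    conjSeminorm (g' * g) (g' • y) ((isotropy (g' • y)).mkQ (g'.1 * ξ * (g'⁻¹).1)) =
      conjSeminorm g y ((isotropy y).mkQ ξ) := by
  have hcancel : ∀ X : Matrix (Fin 3) (Fin 3) ℝ, (g'⁻¹).1 * (g'.1 * X) = X := fun X => by
    rw [← Matrix.mul_assoc, inv_val_mul_val, Matrix.one_mul]
  have hval : ((g' * g)⁻¹).1 = (g⁻¹).1 * (g'⁻¹).1 := by rw [mul_inv_rev]; rfl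
  rw [conjSeminorm_mkQ, conjSeminorm_mkQ, offDiagPart_smul, hval]
  change ‖(g⁻¹).1 * (g'⁻¹).1 * (g'.1 * offDiagPart y ξ * (g'⁻¹).1) * (g'.1 * g.1)‖ = _
  simp only [Matrix.mul_assoc, hcancel]

theorem continuous_conjSeminorm {X : Type*} [TopologicalSpace X] {g : X → G} {y : X → Frame}
    {ξ : X → Matrix (Fin 3) (Fin 3) ℝ} (hg : Continuous g) (hy : Continuous y)
    (hξ : Continuous ξ) :
    Continuous fun x => conjSeminorm (g x) (y x) ((isotropy (y x)).mkQ (ξ x)) := by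
  simp only [conjSeminorm_mkQ]
  exact (((continuous_inv_val.comp hg).mul
    (continuous_offDiagPart.comp (hy.prodMk hξ))).mul (continuous_subtype_val.comp hg)).norm

/-- The vertical norm given over `h` by `conjSeminorm (g h)`, for an equivariant map
`g : H → G`. -/
def equivariantNorm {Γ : Type*} [Group Γ] {ι : Γ →* H} {ρ : Γ →* G} {g : H → G}
    (hg : Continuous g) (heq : ∀ γ h, g (ι γ * h) = ρ γ * g h) : VerticalNorm ι ρ where
  toSeminorm h y := conjSeminorm (g h) y
  definite h y := conjSeminorm_definite (g h) y
  continuous := continuous_conjSeminorm (hg.comp continuous_fst)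
    (continuous_fst.comp continuous_snd) (continuous_snd.comp continuous_snd)
  invariant γ h y ξ := by rw [heq]; exact conjSeminorm_mul_smul (g h) (ρ γ) y ξ

/-! ### The gauge -/

/-- The exponents of `ρ₀(a^{-t})` on the coordinate lines. -/
def aWeight : Fin 3 → ℝ := ![-1, 0, 1]

/-- The exponents of `φ^{-s}` on the coordinate lines. -/
def phiWeight : Fin 3 → ℝ := ![-1 / 3, 2 / 3, -1 / 3]

/-- The eigenvalues of `φ^{-x} ρ₀(a^{-t})` on the coordinate lines. -/
def flowWeight (x t : ℝ) (i : Fin 3) : ℝ :=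
  Real.exp (t * aWeight i + x * phiWeight i)

theorem flowWeight_pos (x t : ℝ) (i : Fin 3) : 0 < flowWeight x t i := Real.exp_pos _

theorem flowWeight_neg (x t : ℝ) (i : Fin 3) : flowWeight (-x) (-t) i = (flowWeight x t i)⁻¹ := by
  rw [flowWeight, flowWeight, ← Real.exp_neg]
  ring_nf

theorem flowWeight_div_le {x t a C : ℝ} (ht : 0 ≤ t) (hx : |x| ≤ (1 - a) * t + C) {i j : Fin 3}
    (hij : i < j) (hC : 0 ≤ C) :
    flowWeight x t i / flowWeight x t j ≤ Real.exp (2 * C) * Real.exp (-a * t) := by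
  rw [flowWeight, flowWeight, ← Real.exp_sub, ← Real.exp_add, Real.exp_le_exp]
  obtain ⟨hx_lower, hx_upper⟩ := abs_le.mp hx
  fin_cases i <;> fin_cases j <;> simp_all [aWeight, phiWeight] <;> linarith

/-- The element `φ^{-x} ρ₀(a^{-t})` of `G`. -/
def flowDiagonal (x t : ℝ) : G := phi (-x) * rho0 (aFlow (-t))

theorem flowDiagonal_val (x t : ℝ) :
    (flowDiagonal x t).1 = Matrix.diagonal (flowWeight x t) := by
  change (phi (-x)).1 * rho0Matrix (aFlow (-t)).1 = _
  ext i j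
  fin_cases i <;> fin_cases j <;>
    simp [phi, rho0Matrix, aFlow, flowWeight, aWeight, phiWeight, Matrix.mul_apply,
      Fin.sum_univ_three, ← Real.exp_add] <;> ring

theorem flowDiagonal_inv (x t : ℝ) : (flowDiagonal x t)⁻¹ = flowDiagonal (-x) (-t) := by
  refine inv_eq_of_mul_eq_one_left (Subtype.ext ?_)
  have hone (i : Fin 3) : flowWeight (-x) (-t) i * flowWeight x t i = 1 := by
    rw [flowWeight_neg, inv_mul_cancel₀ (flowWeight_pos _ _ _).ne']
  rw [Matrix.SpecialLinearGroup.coe_mul, flowDiagonal_val, flowDiagonal_val,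
    Matrix.diagonal_mul_diagonal, funext hone, Matrix.diagonal_one,
    Matrix.SpecialLinearGroup.coe_one]

theorem flowDiagonal_conj_apply (x t : ℝ) (X : Matrix (Fin 3) (Fin 3) ℝ) (i j : Fin 3) :
    ((flowDiagonal x t).1 * X * ((flowDiagonal x t)⁻¹).1) i j =
      flowWeight x t i / flowWeight x t j * X i j := by
  rw [flowDiagonal_inv, flowDiagonal_val, flowDiagonal_val, Matrix.mul_diagonal,
    Matrix.diagonal_mul, flowWeight_neg]
  ring

/-- The map `h ↦ φ^{f(h)} ρ₀(h)` to `G`, by which the flat bundle of `ρ_u` is trivialized when `f`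
has periods `u`. -/
def gauge (f : H → ℝ) (h : H) : G := phi (f h) * rho0 h

theorem continuous_phi : Continuous phi :=
  Continuous.subtype_mk (by fun_prop) _

theorem continuous_rho0 : Continuous rho0 :=
  Continuous.subtype_mk (by unfold rho0Matrix; fun_prop) _

theorem continuous_gauge {f : H → ℝ} (hf : Continuous f) : Continuous (gauge f) :=
  (continuous_phi.comp hf).mul continuous_rho0

theorem gauge_mul_left {Γ : Type*} [Group Γ] {ι : Γ →* H} {u : Γ →* Multiplicative ℝ} {f : H → ℝ}
    (hfu : ∀ γ h, f (ι γ * h) = f h + (u γ).toAdd) (γ : Γ) (h : H) :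
    gauge f (ι γ * h) = linearDeformation ι u γ * gauge f h := by
  change _ = phi (u γ).toAdd * rho0 (ι γ) * _
  rw [gauge, gauge, hfu, add_comm, phi_add, map_mul, mul_assoc, mul_assoc, ← mul_assoc (phi (f h)),
    phi_comm, mul_assoc]

theorem gauge_mul_aFlow_mul_flowDiagonal (f : H → ℝ) (h : H) (t : ℝ) :
    gauge f (h * aFlow t) * flowDiagonal (f (h * aFlow t) - f h) t = gauge f h := by
  rw [flowDiagonal, gauge, gauge, neg_sub, mul_assoc, ← mul_assoc (rho0 _), ← phi_comm, mul_assoc,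
    ← map_mul, mul_aFlow_mul_aFlow_neg, ← mul_assoc, ← phi_add]
  congr 2
  ring

theorem frameOf_gauge_mul_aFlow (f : H → ℝ) (h : H) (t : ℝ) :
    frameOf (gauge f h) = frameOf (gauge f (h * aFlow t)) := by
  refine frameOf_eq_frameOf_iff.mpr ⟨flowWeight (f (h * aFlow t) - f h) t, ?_⟩
  conv_lhs => rw [← gauge_mul_aFlow_mul_flowDiagonal f h t]
  rw [← flowDiagonal_val]
  rfl

/-! ### Slow increments imply the Anosov property -/

section StandardSection

variable {Γ : Type*} [Group Γ] {ι : Γ →* H} {ρ : Γ →* G} {g : H → G}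

/-- The vertical norm over the frame of `g h`, in the coordinates of `g h`. -/
def VerticalNorm.inGauge (N : VerticalNorm ι ρ) (g : H → G) (h : H)
    (X : Matrix (Fin 3) (Fin 3) ℝ) : ℝ :=
  N.toSeminorm h (frameOf (g h)) ((isotropy _).mkQ ((g h).1 * X * ((g h)⁻¹).1))

theorem VerticalNorm.inGauge_smul (N : VerticalNorm ι ρ) (h : H) (c : ℝ)
    (X : Matrix (Fin 3) (Fin 3) ℝ) : N.inGauge g h (c • X) = |c| * N.inGauge g h X := by
  rw [inGauge, Matrix.mul_smul, Matrix.smul_mul, map_smul, map_smul_eq_mul, Real.norm_eq_abs,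
    inGauge]

theorem VerticalNorm.inGauge_pos (N : VerticalNorm ι ρ) (h : H) {X : Matrix (Fin 3) (Fin 3) ℝ}
    (hX : X ≠ 0) (hdiag : ∀ i, X i i = 0) : 0 < N.inGauge g h X := by
  refine (apply_nonneg _ _).lt_of_ne' fun hzero => hX ?_
  have hmem := (mem_isotropy_frameOf_iff _ _).mp
    ((Submodule.Quotient.mk_eq_zero _).mp (N.definite _ _ _ hzero))
  have hconj : (toGL (g h))⁻¹.1 * ((g h).1 * X * ((g h)⁻¹).1) * (toGL (g h)).1 = X := by
    change ((g h)⁻¹).1 * ((g h).1 * X * ((g h)⁻¹).1) * (g h).1 = X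
    rw [Matrix.mul_assoc, Matrix.mul_assoc, inv_val_mul_val, Matrix.mul_one, ← Matrix.mul_assoc,
      inv_val_mul_val, Matrix.one_mul]
  rw [hconj] at hmem
  ext i j
  rcases eq_or_ne i j with rfl | hij
  · exact hdiag i
  · exact hmem i j hij

theorem VerticalNorm.inGauge_mul_left (N : VerticalNorm ι ρ)
    (heq : ∀ γ h, g (ι γ * h) = ρ γ * g h) (γ : Γ) (h : H) (X : Matrix (Fin 3) (Fin 3) ℝ) :
    N.inGauge g (ι γ * h) X = N.inGauge g h X := by
  have hval : (ρ γ * g h).1 * X * ((ρ γ * g h)⁻¹).1 =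
      (ρ γ).1 * ((g h).1 * X * ((g h)⁻¹).1) * ((ρ γ)⁻¹).1 := by
    rw [mul_inv_rev]
    change (ρ γ).1 * (g h).1 * X * (((g h)⁻¹).1 * ((ρ γ)⁻¹).1) = _
    simp only [Matrix.mul_assoc]
  have hframe : frameOf (ρ γ * g h : G) = ρ γ • frameOf (g h) := by
    rw [smul_frameOf, map_mul]
  rw [inGauge, heq, hval, hframe]
  exact N.invariant γ h _ _

theorem VerticalNorm.continuous_inGauge (N : VerticalNorm ι ρ) (hg : Continuous g) :
    Continuous fun p : H × Matrix (Fin 3) (Fin 3) ℝ => N.inGauge g p.1 p.2 := by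
  have hframe : Continuous fun h => frameOf (g h) :=
    continuous_frameOf.comp (Matrix.SpecialLinearGroup.continuous_toGL.comp hg)
  have hconj : Continuous fun p : H × Matrix (Fin 3) (Fin 3) ℝ =>
      (g p.1).1 * p.2 * ((g p.1)⁻¹).1 :=
    ((continuous_subtype_val.comp (hg.comp continuous_fst)).mul continuous_snd).mul
      (continuous_inv_val.comp (hg.comp continuous_fst))
  exact N.continuous.comp (continuous_fst.prodMk ((hframe.comp continuous_fst).prodMk hconj))

theorem isCompact_offDiagonal_sphere :
    IsCompact {X : Matrix (Fin 3) (Fin 3) ℝ | ‖X‖ = 1 ∧ ∀ i, X i i = 0} := by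
  have : ProperSpace (Matrix (Fin 3) (Fin 3) ℝ) := FiniteDimensional.proper ℝ _
  have hclosed : IsClosed {X : Matrix (Fin 3) (Fin 3) ℝ | ∀ i, X i i = 0} := by
    simp only [Set.ofPred_forall]
    exact isClosed_iInter fun i => isClosed_eq (by fun_prop) continuous_const
  have hinter : {X : Matrix (Fin 3) (Fin 3) ℝ | ‖X‖ = 1 ∧ ∀ i, X i i = 0} =
      Metric.sphere 0 1 ∩ {X | ∀ i, X i i = 0} := by
    ext X
    simp
  rw [hinter]
  exact (isCompact_sphere (0 : Matrix (Fin 3) (Fin 3) ℝ) 1).inter_right hclosed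

theorem VerticalNorm.exists_inGauge_bounds_of_norm_eq_one [CompactSpace (M ι)]
    (N : VerticalNorm ι ρ) (hg : Continuous g) (heq : ∀ γ h, g (ι γ * h) = ρ γ * g h) :
    ∃ C > 0, ∀ h, ∀ X : Matrix (Fin 3) (Fin 3) ℝ, ‖X‖ = 1 → (∀ i, X i i = 0) →
      N.inGauge g h X ≤ C ∧ 1 ≤ C * N.inGauge g h X := by
  set S := {X : Matrix (Fin 3) (Fin 3) ℝ | ‖X‖ = 1 ∧ ∀ i, X i i = 0}
  have hS : CompactSpace S := isCompact_iff_compactSpace.mp isCompact_offDiagonal_sphere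
  have hpos : ∀ h, ∀ X : S, 0 < N.inGauge g h X := fun h X =>
    N.inGauge_pos h (norm_ne_zero_iff.mp (by rw [X.2.1]; exact one_ne_zero)) X.2.2
  have hcont : Continuous (Function.uncurry fun (h : H) (X : S) => N.inGauge g h X) :=
    (N.continuous_inGauge hg).comp
      (continuous_fst.prodMk (continuous_subtype_val.comp continuous_snd))
  have hinv : ∀ γ h, (fun X : S => N.inGauge g (ι γ * h) X) = fun X : S => N.inGauge g h X :=
    fun γ h => funext fun X => N.inGauge_mul_left heq γ h X
  obtain ⟨C₁, hC₁_pos, hle⟩ := exists_norm_le_of_invariant hcont hinv isCompact_univ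
  obtain ⟨C₂, -, hge⟩ := exists_norm_le_of_invariant
    (f := fun h (X : S) => (N.inGauge g h X)⁻¹) (hcont.inv₀ fun p => (hpos p.1 p.2).ne')
    (fun γ h => funext fun X => congrArg Inv.inv (congrFun (hinv γ h) X)) isCompact_univ
  refine ⟨max C₁ C₂, lt_max_of_lt_left hC₁_pos, fun h X hnorm hdiag => ?_⟩
  have hX_pos := hpos h ⟨X, hnorm, hdiag⟩
  have hX_ge := (le_abs_self _).trans (hge h ⟨X, hnorm, hdiag⟩ trivial)
  rw [inv_le_iff_one_le_mul₀ hX_pos] at hX_ge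
  exact ⟨((le_abs_self _).trans (hle h ⟨X, hnorm, hdiag⟩ trivial)).trans (le_max_left _ _),
    hX_ge.trans (mul_le_mul_of_nonneg_right (le_max_right _ _) hX_pos.le)⟩

theorem VerticalNorm.exists_inGauge_bounds [CompactSpace (M ι)] (N : VerticalNorm ι ρ)
    (hg : Continuous g) (heq : ∀ γ h, g (ι γ * h) = ρ γ * g h) :
    ∃ C > 0, ∀ h, ∀ X : Matrix (Fin 3) (Fin 3) ℝ, (∀ i, X i i = 0) →
      N.inGauge g h X ≤ C * ‖X‖ ∧ ‖X‖ ≤ C * N.inGauge g h X := by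
  obtain ⟨C, hC, hbounds⟩ := N.exists_inGauge_bounds_of_norm_eq_one hg heq
  refine ⟨C, hC, fun h X hdiag => ?_⟩
  rcases eq_or_ne X 0 with rfl | hX
  · have hzero := N.inGauge_smul (g := g) h 0 0
    rw [zero_smul, abs_zero, zero_mul] at hzero
    simp [hzero]
  have hnorm : 0 < ‖X‖ := norm_pos_iff.mpr hX
  obtain ⟨hle, hge⟩ := hbounds h (‖X‖⁻¹ • X)
    (by rw [norm_smul, norm_inv, norm_norm, inv_mul_cancel₀ hnorm.ne'])
    (fun i => by rw [Matrix.smul_apply, hdiag, smul_zero])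
  rw [N.inGauge_smul, abs_of_pos (inv_pos.mpr hnorm)] at hle hge
  rw [inv_mul_le_iff₀ hnorm, mul_comm] at hle
  rw [mul_left_comm, le_inv_mul_iff₀ hnorm, mul_one] at hge
  exact ⟨hle, hge⟩

end StandardSection

section EquivariantSection

variable {Γ : Type*} [Group Γ] {ι : Γ →* H} {ρ : Γ →* G} {σ : H → Frame}

/-- The section of `E_ρ` induced by an equivariant map from `H` to the frame variety. -/
def equivariantSection (hσ : ∀ γ h, σ (ι γ * h) = ρ γ • σ h) : M ι → E ι ρ :=
  Quotient.map (fun h => (h, σ h)) (by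
    rintro h _ ⟨γ, rfl⟩
    exact ⟨γ, by rw [hσ]⟩)

theorem bundle_mk_eq_mk_iff {h h' : H} {y y' : Frame} :
    Quotient.mk (bundleSetoid ι ρ) (h, y) = Quotient.mk (bundleSetoid ι ρ) (h', y') ↔
      ∃ γ, h' = ι γ * h ∧ y' = ρ γ • y :=
  Quotient.eq.trans (exists_congr fun _ => Prod.ext_iff)

theorem mk_mem_range_equivariantSection_iff (hσ : ∀ γ h, σ (ι γ * h) = ρ γ • σ h) {h : H}
    {y : Frame} :
    Quotient.mk (bundleSetoid ι ρ) (h, y) ∈ Set.range (equivariantSection hσ) ↔ y = σ h := by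
  refine ⟨?_, fun hy => ⟨Quotient.mk _ h, by rw [hy]; rfl⟩⟩
  rintro ⟨p, hp⟩
  induction p using Quotient.inductionOn with
  | h k =>
    obtain ⟨γ, rfl, rfl⟩ := bundle_mk_eq_mk_iff.mp hp
    exact (hσ γ k).symm

theorem isAnosov_of_equivariant (hcont : Continuous σ) (hσ : ∀ γ h, σ (ι γ * h) = ρ γ • σ h)
    (hflow : ∀ h t, σ (h * aFlow t) = σ h)
    (hyperbolic : ∀ N : VerticalNorm ι ρ, ∃ a > 0, ∃ b > 0, ∀ h t, 0 < t →
      (∀ v ∈ EPlus (σ h), N.toSeminorm (h * aFlow t) (σ h) v ≤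
        b * Real.exp (-a * t) * N.toSeminorm h (σ h) v) ∧
      (∀ v ∈ EMinus (σ h), N.toSeminorm (h * aFlow (-t)) (σ h) v ≤
        b * Real.exp (-a * t) * N.toSeminorm h (σ h) v)) :
    IsAnosov ι ρ := by
  refine ⟨equivariantSection hσ,
    { continuous := (continuous_quotient_mk'.comp (continuous_id.prodMk hcont)).quotient_lift _
      isSection := fun p => Quotient.inductionOn p fun _ => rfl
      invariant := ?_
      hyperbolic := fun N => ?_ }⟩
  · rintro t _ ⟨p, rfl⟩
    induction p using Quotient.inductionOn with
    | h k => exact (mk_mem_range_equivariantSection_iff hσ).mpr (hflow k t).symm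
  · obtain ⟨a, ha, b, hb, hN⟩ := hyperbolic N
    refine ⟨a, ha, b, hb, fun h y hy => ?_⟩
    rw [mk_mem_range_equivariantSection_iff hσ] at hy
    subst hy
    exact hN h

end EquivariantSection

theorem norm_flowDiagonal_conj_le {x t r : ℝ} {X : Matrix (Fin 3) (Fin 3) ℝ} (hr : 0 ≤ r)
    (hX : ∀ i j, X i j ≠ 0 → flowWeight x t i / flowWeight x t j ≤ r) :
    ‖(flowDiagonal x t).1 * X * ((flowDiagonal x t)⁻¹).1‖ ≤ r * ‖X‖ := by
  rw [linfty_opNorm_le_iff (by positivity)]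
  intro i
  have hentry (j : Fin 3) :
      ‖((flowDiagonal x t).1 * X * ((flowDiagonal x t)⁻¹).1) i j‖ ≤ r * ‖X i j‖ := by
    rw [flowDiagonal_conj_apply, norm_mul, Real.norm_of_nonneg
      (div_pos (flowWeight_pos x t i) (flowWeight_pos x t j)).le]
    rcases eq_or_ne (X i j) 0 with hzero | hne
    · simp [hzero]
    · exact mul_le_mul_of_nonneg_right (hX i j hne) (norm_nonneg _)
  calc ∑ j, ‖((flowDiagonal x t).1 * X * ((flowDiagonal x t)⁻¹).1) i j‖
      ≤ ∑ j, r * ‖X i j‖ := Finset.sum_le_sum fun j _ => hentry j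
    _ = r * ∑ j, ‖X i j‖ := (Finset.mul_sum _ _ _).symm
    _ ≤ r * ‖X‖ := mul_le_mul_of_nonneg_left
        ((linfty_opNorm_le_iff (norm_nonneg X)).mp le_rfl i) hr

section SlowIncrements

variable {Γ : Type*} [Group Γ] {ι : Γ →* H} {u : Γ →* Multiplicative ℝ} {f : H → ℝ}

/-- The increments of `f` along the flow are, up to a bounded error, at most `1 - a` times the
elapsed time, for some `a > 0`. For `f` with periods `u` this is equivalent to `|u|_s < 1/2`. -/
def HasSlowIncrements (f : H → ℝ) : Prop :=
  ∃ a > 0, ∃ C, ∀ h t, |f (h * aFlow t) - f h| ≤ (1 - a) * |t| + C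

theorem VerticalNorm.toSeminorm_mul_aFlow_gauge {ρ : Γ →* G} (N : VerticalNorm ι ρ) (f : H → ℝ)
    (h : H) (t : ℝ) (X : Matrix (Fin 3) (Fin 3) ℝ) :
    N.toSeminorm (h * aFlow t) (frameOf (gauge f h))
        ((isotropy _).mkQ ((gauge f h).1 * X * ((gauge f h)⁻¹).1)) =
      N.inGauge (gauge f) (h * aFlow t)
        ((flowDiagonal (f (h * aFlow t) - f h) t).1 * X *
          ((flowDiagonal (f (h * aFlow t) - f h) t)⁻¹).1) := by
  have hcongr {y y' : Frame} {ξ ξ' : Matrix (Fin 3) (Fin 3) ℝ} (hy : y = y') (hξ : ξ = ξ') :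
      N.toSeminorm (h * aFlow t) y ((isotropy y).mkQ ξ) =
        N.toSeminorm (h * aFlow t) y' ((isotropy y').mkQ ξ') := by
    subst hy hξ
    rfl
  refine hcongr (frameOf_gauge_mul_aFlow f h t) ?_
  conv_lhs => rw [← gauge_mul_aFlow_mul_flowDiagonal f h t, mul_inv_rev,
    Matrix.SpecialLinearGroup.coe_mul, Matrix.SpecialLinearGroup.coe_mul]
  simp only [Matrix.mul_assoc]

theorem VerticalNorm.exists_toSeminorm_mul_aFlow_le [CompactSpace (M ι)]
    (N : VerticalNorm ι (linearDeformation ι u)) (hf : Continuous f)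
    (hfu : ∀ γ h, f (ι γ * h) = f h + (u γ).toAdd) :
    ∃ C > 0, ∀ h t r, 0 ≤ r → ∀ X : Matrix (Fin 3) (Fin 3) ℝ, (∀ i, X i i = 0) →
      (∀ i j, X i j ≠ 0 → flowWeight (f (h * aFlow t) - f h) t i /
        flowWeight (f (h * aFlow t) - f h) t j ≤ r) →
      N.toSeminorm (h * aFlow t) (frameOf (gauge f h))
          ((isotropy _).mkQ ((gauge f h).1 * X * ((gauge f h)⁻¹).1)) ≤
        C * r * N.inGauge (gauge f) h X := by
  obtain ⟨C, hC, hbounds⟩ := N.exists_inGauge_bounds (continuous_gauge hf) (gauge_mul_left hfu)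
  refine ⟨C * C, by positivity, fun h t r hr X hdiag hX => ?_⟩
  rw [N.toSeminorm_mul_aFlow_gauge]
  set d := flowDiagonal (f (h * aFlow t) - f h) t
  have hdiag_conj (i : Fin 3) : (d.1 * X * (d⁻¹).1) i i = 0 := by
    rw [flowDiagonal_conj_apply, hdiag, mul_zero]
  calc N.inGauge (gauge f) (h * aFlow t) (d.1 * X * (d⁻¹).1)
      ≤ C * ‖d.1 * X * (d⁻¹).1‖ := (hbounds _ _ hdiag_conj).1
    _ ≤ C * (r * ‖X‖) := mul_le_mul_of_nonneg_left (norm_flowDiagonal_conj_le hr hX) hC.le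
    _ ≤ C * (r * (C * N.inGauge (gauge f) h X)) := by
        gcongr
        exact (hbounds h X hdiag).2
    _ = C * C * r * N.inGauge (gauge f) h X := by ring

theorem HasSlowIncrements.exists_flowWeight_div_le (hslow : HasSlowIncrements f) :
    ∃ a > 0, ∃ b > 0, ∀ h t, 0 ≤ t → ∀ i j : Fin 3, i < j →
      flowWeight (f (h * aFlow t) - f h) t i / flowWeight (f (h * aFlow t) - f h) t j ≤
        b * Real.exp (-a * t) ∧
      flowWeight (f (h * aFlow (-t)) - f h) (-t) j / flowWeight (f (h * aFlow (-t)) - f h) (-t) i ≤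
        b * Real.exp (-a * t) := by
  obtain ⟨a, ha, C, hincr⟩ := hslow
  have hC : 0 ≤ C := by simpa [aFlow_zero] using hincr 1 0
  refine ⟨a, ha, Real.exp (2 * C), Real.exp_pos _, fun h t ht i j hij => ⟨?_, ?_⟩⟩
  · exact flowWeight_div_le ht (by simpa [abs_of_nonneg ht] using hincr h t) hij hC
  · have hbackward : |-(f (h * aFlow (-t)) - f h)| ≤ (1 - a) * t + C := by
      rw [abs_neg]
      simpa [abs_of_nonneg ht] using hincr h (-t)
    have hweight (k : Fin 3) : flowWeight (f (h * aFlow (-t)) - f h) (-t) k =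
        (flowWeight (-(f (h * aFlow (-t)) - f h)) t k)⁻¹ := by
      rw [← flowWeight_neg, neg_neg]
    rw [hweight, hweight, inv_div_inv]
    exact flowWeight_div_le ht hbackward hij hC

theorem HasSlowIncrements.isAnosov [CompactSpace (M ι)] (hslow : HasSlowIncrements f)
    (hf : Continuous f) (hfu : ∀ γ h, f (ι γ * h) = f h + (u γ).toAdd) :
    IsAnosov ι (linearDeformation ι u) := by
  have hcont : Continuous fun h => frameOf (gauge f h) :=
    continuous_frameOf.comp (Matrix.SpecialLinearGroup.continuous_toGL.comp (continuous_gauge hf))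
  have heq (γ : Γ) (h : H) :
      frameOf (gauge f (ι γ * h)) = linearDeformation ι u γ • frameOf (gauge f h) := by
    rw [gauge_mul_left hfu, map_mul, smul_frameOf]
  refine isAnosov_of_equivariant hcont heq (fun h t => (frameOf_gauge_mul_aFlow f h t).symm)
    fun N => ?_
  obtain ⟨a, ha, b, hb, hweight⟩ := hslow.exists_flowWeight_div_le
  obtain ⟨C, hC, hN⟩ := N.exists_toSeminorm_mul_aFlow_le hf hfu
  have hrate (t : ℝ) : 0 ≤ b * Real.exp (-a * t) := by positivity
  refine ⟨a, ha, C * b, by positivity, fun h t ht => ⟨fun v hv => ?_, fun v hv => ?_⟩⟩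
  · obtain ⟨X, hX, rfl⟩ := (mem_EPlus_frameOf_iff _ _).mp hv
    rw [mul_assoc C]
    exact hN h t _ (hrate t) X (fun i => hX i i le_rfl) fun i j hij =>
      (hweight h t ht.le i j (lt_of_not_ge (mt (hX i j) hij))).1
  · obtain ⟨X, hX, rfl⟩ := (mem_EMinus_frameOf_iff _ _).mp hv
    rw [mul_assoc C]
    exact hN h (-t) _ (hrate t) X (fun i => hX i i le_rfl) fun i j hij =>
      (hweight h t ht.le j i (lt_of_not_ge (mt (hX i j) hij))).2

end SlowIncrements

/-! ### Bounded periods imply slow increments -/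

section Periods

variable {Γ : Type*} [Group Γ] {ι : Γ →* H} {u : Γ →* Multiplicative ℝ} {f : H → ℝ}

theorem norm_aFlow_le (t : ℝ) : ‖(aFlow t).1‖ ≤ Real.exp |t| := by
  rw [linfty_opNorm_le_iff (Real.exp_pos _).le]
  intro i
  fin_cases i <;> simp [aFlow, le_abs_self, neg_le_abs]

theorem exists_forall_period_approx [CompactSpace (M ι)] (hf : Continuous f)
    (hfu : ∀ γ h, f (ι γ * h) = f h + (u γ).toAdd) :
    ∃ C, ∀ h t, ∃ γ, |f (h * aFlow t) - f h - (u γ).toAdd| ≤ C ∧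
      transLength ι γ ≤ 2 * |t| + C := by
  obtain ⟨K, hK, hcover⟩ := exists_isCompact_cover (ι := ι)
  obtain ⟨A, hA⟩ := hK.exists_bound_of_continuousOn hf.continuousOn
  obtain ⟨B, hB⟩ := hK.exists_bound_of_continuousOn (f := fun k : H => k.1)
    continuous_subtype_val.continuousOn
  obtain ⟨B', hB'⟩ := hK.exists_bound_of_continuousOn (f := fun k : H => (k⁻¹).1)
    continuous_inv_val.continuousOn
  refine ⟨max (2 * A) (2 * Real.log (B * B')), fun h t => ?_⟩
  obtain ⟨γ₁, k₁, hk₁, rfl⟩ := hcover h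
  obtain ⟨γ₂, k₂, hk₂, hend⟩ := hcover (ι γ₁ * k₁ * aFlow t)
  refine ⟨γ₁⁻¹ * γ₂, le_max_of_le_left ?_, (add_le_add_right (le_max_right _ _) _).trans' ?_⟩
  · rw [hend, hfu, hfu, map_mul, map_inv, toAdd_mul, toAdd_inv]
    have h₁ := abs_le.mp (hA k₁ hk₁)
    have h₂ := abs_le.mp (hA k₂ hk₂)
    rw [abs_le]
    constructor <;> linarith
  · have hholonomy : ι (γ₁⁻¹ * γ₂) = k₁ * aFlow t * k₂⁻¹ := by
      rw [map_mul, map_inv, eq_mul_inv_iff_mul_eq, mul_assoc, ← hend]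
      group
    have hspec : specRadius ι (γ₁⁻¹ * γ₂) ≤ B * Real.exp |t| * B' := by
      refine (specRadius_le_norm _).trans ?_
      rw [hholonomy, Matrix.SpecialLinearGroup.coe_mul, Matrix.SpecialLinearGroup.coe_mul]
      calc ‖k₁.1 * (aFlow t).1 * (k₂⁻¹).1‖
          ≤ ‖k₁.1‖ * ‖(aFlow t).1‖ * ‖(k₂⁻¹).1‖ := norm_mul₃_le
        _ ≤ B * Real.exp |t| * B' := by
          have hB_nonneg := (norm_nonneg _).trans (hB k₁ hk₁)
          gcongr
          exacts [hB k₁ hk₁, norm_aFlow_le t, hB' k₂ hk₂]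
    have hBB' : 0 < B * B' :=
      pos_of_mul_pos_left (by linarith [one_le_specRadius (ι := ι) (γ₁⁻¹ * γ₂)])
        (Real.exp_pos |t|).le
    have hlog := Real.log_le_log (one_pos.trans_le (one_le_specRadius _)) hspec
    rw [mul_right_comm, Real.log_mul hBB'.ne' (Real.exp_pos _).ne', Real.log_exp] at hlog
    rw [transLength]
    linarith

theorem HasSlowIncrements.of_period_le [CompactSpace (M ι)] (hf : Continuous f)
    (hfu : ∀ γ h, f (ι γ * h) = f h + (u γ).toAdd) {κ : ℝ} (hκ_nonneg : 0 ≤ κ) (hκ : κ < 1 / 2)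
    (hu : ∀ γ, |(u γ).toAdd| ≤ κ * transLength ι γ) : HasSlowIncrements f := by
  obtain ⟨C, hC⟩ := exists_forall_period_approx hf hfu
  refine ⟨1 - 2 * κ, by linarith, C + κ * C, fun h t => ?_⟩
  obtain ⟨γ, hincr, hlength⟩ := hC h t
  calc |f (h * aFlow t) - f h|
      ≤ |f (h * aFlow t) - f h - (u γ).toAdd| + |(u γ).toAdd| := by
        simpa using abs_add_le (f (h * aFlow t) - f h - (u γ).toAdd) (u γ).toAdd
    _ ≤ C + κ * (2 * |t| + C) :=
        add_le_add hincr ((hu γ).trans (mul_le_mul_of_nonneg_left hlength hκ_nonneg))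
    _ = (1 - (1 - 2 * κ)) * |t| + (C + κ * C) := by ring

end Periods

/-! ### Anosov sections as equivariant maps -/

section Lift

variable {Γ : Type*} [Group Γ] {ι : Γ →* H} {ρ : Γ →* G}

theorem eq_of_mk_eq_mk (hinj : Function.Injective ι) {h : H} {y y' : Frame}
    (hmk : Quotient.mk (bundleSetoid ι ρ) (h, y) = Quotient.mk (bundleSetoid ι ρ) (h, y')) :
    y = y' := by
  obtain ⟨γ, hh, hy⟩ := bundle_mk_eq_mk_iff.mp hmk
  have hγ_one : γ = 1 := (map_eq_one_iff ι hinj).mp (mul_eq_right.mp hh.symm)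
  rw [hγ_one, map_one, one_smul] at hy
  exact hy.symm

theorem exists_mk_eq_of_bundleProj_eq {h : H} {p : E ι ρ}
    (hp : bundleProj ι ρ p = Quotient.mk (orbitSetoid ι) h) :
    ∃ y, Quotient.mk (bundleSetoid ι ρ) (h, y) = p := by
  induction p using Quotient.inductionOn with
  | h q =>
    obtain ⟨γ, rfl⟩ : ∃ γ, h = ι γ * q.1 := Quotient.exact hp
    exact ⟨ρ γ • q.2, (bundle_mk_eq_mk_iff.mpr ⟨γ, rfl, rfl⟩).symm⟩

theorem continuous_of_continuous_mk (hinj : Function.Injective ι) [DiscreteTopology ι.range]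
    {σ : H → Frame} (hσ : Continuous fun h => Quotient.mk (bundleSetoid ι ρ) (h, σ h)) :
    Continuous σ := by
  have isOpenMap_mk : IsOpenMap (Quotient.mk (bundleSetoid ι ρ)) :=
    isOpenMap_quotientMk (f := fun γ p => (ι γ * p.1, ρ γ • p.2))
      (fun γ => (continuous_const.mul continuous_fst).prodMk
        ((continuous_smul_frame (ρ γ)).comp continuous_snd)) fun _ _ => Iff.rfl
  refine continuous_iff_continuousAt.mpr fun h₀ U hU => ?_
  obtain ⟨W, hW, hh₀W, hW_one⟩ := exists_isOpen_forall_mul_mem_eq_one hinj h₀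
  obtain ⟨U', hU'U, hU', hσU'⟩ := mem_nhds_iff.mp hU
  have hnear := ((isOpenMap_mk _ (hW.prod hU')).preimage hσ).mem_nhds
    ⟨(h₀, σ h₀), ⟨hh₀W, hσU'⟩, rfl⟩
  rw [Filter.mem_map]
  filter_upwards [hnear, hW.mem_nhds hh₀W] with h hmk hhW
  obtain ⟨⟨w, y⟩, ⟨hwW, hyU'⟩, hwy⟩ := hmk
  obtain ⟨γ, rfl, hy⟩ := bundle_mk_eq_mk_iff.mp hwy
  obtain rfl := hW_one γ w hwW hhW
  rw [map_one ρ, one_smul] at hy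
  exact hU'U (hy ▸ hyU')

theorem IsAnosovSection.exists_lift (hinj : Function.Injective ι) [DiscreteTopology ι.range]
    {s : M ι → E ι ρ} (hs : IsAnosovSection ι ρ s) :
    ∃ σ : H → Frame, Continuous σ ∧ (∀ γ h, σ (ι γ * h) = ρ γ • σ h) ∧
      (∀ h t, σ (h * aFlow t) = σ h) ∧
      ∀ h, Quotient.mk (bundleSetoid ι ρ) (h, σ h) = s (Quotient.mk (orbitSetoid ι) h) := by
  choose σ hσ using fun h => exists_mk_eq_of_bundleProj_eq (hs.isSection (Quotient.mk _ h))
  refine ⟨σ, continuous_of_continuous_mk (ρ := ρ) hinj ?_, fun γ h => ?_, fun h t => ?_, hσ⟩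
  · rw [funext hσ]
    exact hs.continuous.comp continuous_quotient_mk'
  · have hsame : Quotient.mk (orbitSetoid ι) h = Quotient.mk (orbitSetoid ι) (ι γ * h) :=
      Quotient.sound ⟨γ, rfl⟩
    refine eq_of_mk_eq_mk (ρ := ρ) hinj ((hσ _).trans ?_)
    rw [← hsame, ← hσ]
    exact bundle_mk_eq_mk_iff.mpr ⟨γ, rfl, rfl⟩
  · obtain ⟨p, hp⟩ := hs.invariant t ⟨Quotient.mk (orbitSetoid ι) h, rfl⟩
    have hp_eq : p = Quotient.mk (orbitSetoid ι) (h * aFlow t) := by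
      rw [← hs.isSection p, hp, ← hσ]
      rfl
    refine eq_of_mk_eq_mk (ρ := ρ) hinj ((hσ _).trans ?_)
    rw [← hp_eq, hp, ← hσ]
    rfl

end Lift

/-! ### The growth of the lines of an Anosov section -/

theorem linfty_opNorm_vecMulVec {m n : Type*} [Fintype m] [Fintype n] (v : m → ℝ) (w : n → ℝ) :
    ‖Matrix.vecMulVec v w‖ = ‖v‖ * ∑ j, ‖w j‖ := by
  simp only [Matrix.linfty_opNorm_def, Matrix.vecMulVec_apply, nnnorm_mul, ← Finset.mul_sum,
    ← NNReal.finset_sup_mul, NNReal.coe_mul, Pi.norm_def, NNReal.coe_sum, coe_nnnorm]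

theorem norm_conj_single (F : GL (Fin 3) ℝ) (i j : Fin 3) :
    ‖F.1 * Matrix.single i j 1 * (F⁻¹).1‖ = ‖F.1.col i‖ * ∑ k, ‖(F⁻¹).1 j k‖ := by
  rw [Matrix.single_eq_single_vecMulVec_single, Matrix.mul_vecMulVec, Matrix.vecMulVec_mul,
    Matrix.mulVec_single_one, Matrix.single_one_vecMul, linfty_opNorm_vecMulVec]
  rfl

theorem ne_zero_of_eq_mul_diagonal {F : GL (Fin 3) ℝ} {A : Matrix (Fin 3) (Fin 3) ℝ}
    {m : Fin 3 → ℝ} (hm : F.1 = A * Matrix.diagonal m) (j : Fin 3) : m j ≠ 0 := fun hmj =>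
  (linearIndependent_col F).ne_zero j <| by
    ext k
    rw [hm, Matrix.col_apply, Matrix.mul_diagonal, hmj, mul_zero, Pi.zero_apply]

theorem conj_single_eq_smul {F F' : GL (Fin 3) ℝ} {m : Fin 3 → ℝ}
    (hm : F.1 = F'.1 * Matrix.diagonal m) (i j : Fin 3) :
    F.1 * Matrix.single i j 1 * (F⁻¹).1 =
      (m i / m j) • (F'.1 * Matrix.single i j 1 * (F'⁻¹).1) := by
  have hsingle : Matrix.diagonal m * Matrix.single i j 1 =
      (m i / m j) • (Matrix.single i j 1 * Matrix.diagonal m) := by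
    ext k l
    by_cases hkl : i = k ∧ j = l
    · obtain ⟨rfl, rfl⟩ := hkl
      simp [div_mul_cancel₀ _ (ne_zero_of_eq_mul_diagonal hm _)]
    · simp [Matrix.single_apply_of_ne _ _ _ _ _ hkl]
  rw [Units.mul_inv_eq_iff_eq_mul, Matrix.smul_mul, hm, ← Matrix.mul_assoc _ F'.1,
    Units.inv_mul_cancel_right, Matrix.mul_assoc, hsingle, Matrix.mul_smul, Matrix.mul_assoc]

/-- `F` is the matrix of the frame `y` in the coordinates given by `g`, with columns normalized to
have sup norm `1`. -/
structure IsNormalizedFrame (g : G) (y : Frame) (F : GL (Fin 3) ℝ) : Prop where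
  frameOf_mul : frameOf (g * F) = y
  norm_col : ∀ j, ‖F.1.col j‖ = 1

theorem exists_isNormalizedFrame (g : G) (y : Frame) : ∃ F, IsNormalizedFrame g y F := by
  obtain ⟨F, hF, hF_norm⟩ := exists_frameOf_eq_and_norm_col_eq_one (g⁻¹ • y)
  exact ⟨F, by rw [← smul_frameOf, hF, smul_inv_smul], hF_norm⟩

namespace IsNormalizedFrame

variable {g g' : G} {y : Frame} {F F' : GL (Fin 3) ℝ}

theorem frameOf_eq (hF : IsNormalizedFrame g y F) : frameOf F = g⁻¹ • y := by
  rw [← hF.frameOf_mul, ← smul_frameOf, inv_smul_smul]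

theorem abs_le_one (hF : IsNormalizedFrame g y F) (i j : Fin 3) : |F.1 i j| ≤ 1 :=
  hF.norm_col j ▸ norm_le_pi_norm (F.1.col j) i

theorem norm_lineProj (hF : IsNormalizedFrame g y F) (j : Fin 3) :
    ‖lineProj (g⁻¹ • y) j‖ = ∑ k, ‖(F⁻¹).1 j k‖ := by
  rw [← hF.frameOf_eq, lineProj_frameOf, norm_conj_single, hF.norm_col, one_mul]

theorem abs_inv_le (hF : IsNormalizedFrame g y F) (i j : Fin 3) :
    |(F⁻¹).1 i j| ≤ ‖lineProj (g⁻¹ • y) i‖ :=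
  hF.norm_lineProj i ▸ Finset.single_le_sum (f := fun k => ‖(F⁻¹).1 i k‖)
    (fun _ _ => norm_nonneg _) (Finset.mem_univ j)

theorem conjSeminorm_conj_single (hF : IsNormalizedFrame g y F) {i j : Fin 3} (hij : i ≠ j) :
    conjSeminorm g y ((isotropy y).mkQ
      ((toGL g * F).1 * Matrix.single i j 1 * ((toGL g * F)⁻¹).1)) = ‖lineProj (g⁻¹ • y) j‖ := by
  have hy : g • frameOf F = y := (smul_frameOf g F).trans hF.frameOf_mul
  have hval : (toGL g * F).1 * Matrix.single i j 1 * ((toGL g * F)⁻¹).1 =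
      g.1 * (F.1 * Matrix.single i j 1 * (F⁻¹).1) * (g⁻¹).1 := by
    rw [mul_inv_rev, Units.val_mul, Units.val_mul]
    simp only [Matrix.mul_assoc]
    rfl
  have hoff := offDiagPart_frameOf_conj F (Matrix.single i j 1)
  rw [Matrix.diag_single_of_ne _ _ _ hij, Pi.zero_def, Matrix.diagonal_zero, sub_zero] at hoff
  have hconj := conjSeminorm_mul_smul 1 g (frameOf F) (F.1 * Matrix.single i j 1 * (F⁻¹).1)
  rw [mul_one, conjSeminorm_mkQ 1, hoff, inv_one, Matrix.SpecialLinearGroup.coe_one, one_mul,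
    mul_one, norm_conj_single, hF.norm_col, one_mul, ← hF.norm_lineProj, ← hval, hy] at hconj
  exact hconj

theorem abs_le_of_conjSeminorm_le (hF : IsNormalizedFrame g y F) (hF' : IsNormalizedFrame g' y F')
    {m : Fin 3 → ℝ} (hm : (toGL g * F).1 = (toGL g' * F').1 * Matrix.diagonal m) {i j : Fin 3}
    (hij : i ≠ j) {c : ℝ}
    (hle : conjSeminorm g' y ((isotropy y).mkQ
        ((toGL g * F).1 * Matrix.single i j 1 * ((toGL g * F)⁻¹).1)) ≤
      c * conjSeminorm g y ((isotropy y).mkQ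
        ((toGL g * F).1 * Matrix.single i j 1 * ((toGL g * F)⁻¹).1))) :
    |m i| ≤ c * ‖lineProj (g⁻¹ • y) j‖ * |m j| := by
  rw [hF.conjSeminorm_conj_single hij, conj_single_eq_smul hm, map_smul, map_smul_eq_mul,
    hF'.conjSeminorm_conj_single hij, Real.norm_eq_abs, abs_div] at hle
  have hratio : |m i| / |m j| ≤ c * ‖lineProj (g⁻¹ • y) j‖ :=
    (le_mul_of_one_le_right (by positivity) (one_le_norm_lineProj _ j)).trans hle
  rwa [div_le_iff₀ (abs_pos.mpr (ne_zero_of_eq_mul_diagonal hm j))] at hratio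

theorem mkQ_conj_single_mem_EPlus (hF : IsNormalizedFrame g y F) {i j : Fin 3} (hij : i < j) :
    (isotropy y).mkQ ((toGL g * F).1 * Matrix.single i j 1 * ((toGL g * F)⁻¹).1) ∈ EPlus y := by
  obtain rfl := hF.frameOf_mul
  refine (mem_EPlus_frameOf_iff _ _).mpr ⟨_, fun k l hlk => ?_, rfl⟩
  exact Matrix.single_apply_of_ne _ _ _ _ _ (by rintro ⟨rfl, rfl⟩; exact hij.not_ge hlk)

theorem mkQ_conj_single_mem_EMinus (hF : IsNormalizedFrame g y F) {i j : Fin 3} (hij : i < j) :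
    (isotropy y).mkQ ((toGL g * F).1 * Matrix.single j i 1 * ((toGL g * F)⁻¹).1) ∈ EMinus y := by
  obtain rfl := hF.frameOf_mul
  refine (mem_EMinus_frameOf_iff _ _).mpr ⟨_, fun k l hkl => ?_, rfl⟩
  exact Matrix.single_apply_of_ne _ _ _ _ _ (by rintro ⟨rfl, rfl⟩; exact hij.not_ge hkl)

theorem exists_diagonal (hF : IsNormalizedFrame g y F) (hF' : IsNormalizedFrame g' y F') {D : G}
    (hD : g' * D = g) {d : Fin 3 → ℝ} (hd : D.1 = Matrix.diagonal d) (hd_pos : ∀ i, 0 < d i) :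
    ∃ m : Fin 3 → ℝ, (toGL g * F).1 = (toGL g' * F').1 * Matrix.diagonal m ∧
      (∀ i j, d i * |F.1 i j| ≤ |m j|) ∧
      ∀ i j, |m j| * |(F⁻¹).1 j i| ≤ ‖lineProj (g'⁻¹ • y) j‖ * d i := by
  obtain ⟨m, hm⟩ := frameOf_eq_frameOf_iff.mp (hF.frameOf_mul.trans hF'.frameOf_mul.symm)
  have hm_left : Matrix.diagonal d * F.1 = F'.1 * Matrix.diagonal m := by
    rw [← hD, map_mul, mul_assoc, Units.val_mul, Units.val_mul _ F', Matrix.mul_assoc] at hm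
    rw [← hd]
    exact (toGL g').isUnit.mul_left_cancel hm
  have hm_right : (F'⁻¹).1 * Matrix.diagonal d = Matrix.diagonal m * (F⁻¹).1 := by
    rw [Units.eq_mul_inv_iff_mul_eq, Matrix.mul_assoc, hm_left, Units.inv_mul_cancel_left]
  refine ⟨m, hm, fun i j => ?_, fun i j => ?_⟩
  · have hij := congrArg abs (congrFun₂ hm_left i j)
    rw [Matrix.diagonal_mul, Matrix.mul_diagonal, abs_mul, abs_mul, abs_of_pos (hd_pos i)] at hij
    exact hij ▸ mul_le_of_le_one_left (abs_nonneg _) (hF'.abs_le_one i j)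
  · have hij := congrArg abs (congrFun₂ hm_right j i)
    rw [Matrix.diagonal_mul, Matrix.mul_diagonal, abs_mul, abs_mul, abs_of_pos (hd_pos i)] at hij
    exact hij ▸ mul_le_mul_of_nonneg_right (hF'.abs_inv_le j i) (hd_pos i).le

end IsNormalizedFrame

section Growth

variable {Γ : Type*} [Group Γ] {ι : Γ →* H} {ρ : Γ →* G} {g : H → G} {σ : H → Frame}

theorem exists_norm_lineProj_inv_smul_le [CompactSpace (M ι)] (hg : Continuous g)
    (heq : ∀ γ h, g (ι γ * h) = ρ γ * g h) (hσ : Continuous σ)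
    (hσ_eq : ∀ γ h, σ (ι γ * h) = ρ γ • σ h) :
    ∃ B > 0, ∀ h j, ‖lineProj ((g h)⁻¹ • σ h) j‖ ≤ B := by
  have hcont : Continuous (Function.uncurry fun h j => lineProj ((g h)⁻¹ • σ h) j) := by
    simp only [lineProj_smul, inv_inv]
    refine continuous_prod_of_discrete_right.mpr fun j => ?_
    exact ((continuous_inv_val.comp hg).mul ((continuous_lineProj j).comp hσ)).mul
      (continuous_subtype_val.comp hg)
  have hinv : ∀ γ h, (fun j => lineProj ((g (ι γ * h))⁻¹ • σ (ι γ * h)) j) =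
      fun j => lineProj ((g h)⁻¹ • σ h) j := fun γ h => by
    rw [heq, hσ_eq, mul_inv_rev, mul_smul, inv_smul_smul]
  obtain ⟨B, hB_pos, hB⟩ := exists_norm_le_of_invariant hcont hinv isCompact_univ
  exact ⟨B, hB_pos, fun h j => hB h j trivial⟩

/-- `F` is the matrix of a frame whose lines grow under the diagonal matrices `d t` at the rates
`m t`, up to the constant `C`, where `m t i / m t j` decays like `exp (-a * t)` as `t → ∞`, and like
`exp (a * t)` with the roles of `i` and `j` exchanged as `t → -∞`, for `i < j`. -/
structure IsDominatedFrame (a C : ℝ) (d m : ℝ → Fin 3 → ℝ) (F : GL (Fin 3) ℝ) : Prop where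
  pos : ∀ t j, 0 < m t j
  abs_le_one : ∀ i j, |F.1 i j| ≤ 1
  abs_inv_le : ∀ i j, |(F⁻¹).1 i j| ≤ C
  mul_abs_le : ∀ t i j, d t i * |F.1 i j| ≤ m t j
  mul_abs_inv_le : ∀ t i j, m t j * |(F⁻¹).1 j i| ≤ C * d t i
  le_forward : ∀ t, 0 < t → ∀ i j, i < j → m t i ≤ C * Real.exp (-a * t) * m t j
  le_backward : ∀ t, 0 < t → ∀ i j, i < j → m (-t) j ≤ C * Real.exp (-a * t) * m (-t) i

theorem IsAnosovSection.exists_isDominatedFrame (hinj : Function.Injective ι)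
    [DiscreteTopology ι.range] [CompactSpace (M ι)] {u : Γ →* Multiplicative ℝ}
    {s : M ι → E ι (linearDeformation ι u)} (hs : IsAnosovSection ι (linearDeformation ι u) s)
    {f : H → ℝ} (hf : Continuous f) (hfu : ∀ γ h, f (ι γ * h) = f h + (u γ).toAdd) :
    ∃ a > 0, ∃ C > 0, ∀ h, ∃ F m,
      IsDominatedFrame a C (fun t => flowWeight (f (h * aFlow t) - f h) t) m F := by
  obtain ⟨σ, hσ, hσ_eq, hσ_flow, hσs⟩ := hs.exists_lift hinj
  have heq := gauge_mul_left hfu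
  obtain ⟨B, hB_pos, hB⟩ :=
    exists_norm_lineProj_inv_smul_le (continuous_gauge hf) heq hσ hσ_eq
  obtain ⟨a, ha, b, hb, hyp⟩ := hs.hyperbolic (equivariantNorm (continuous_gauge hf) heq)
  choose F hF using fun h => exists_isNormalizedFrame (gauge f h) (σ h)
  have hF_flow : ∀ h t, IsNormalizedFrame (gauge f (h * aFlow t)) (σ h) (F (h * aFlow t)) :=
    fun h t => hσ_flow h t ▸ hF (h * aFlow t)
  have hB_flow : ∀ h t j, ‖lineProj ((gauge f (h * aFlow t))⁻¹ • σ h) j‖ ≤ B :=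
    fun h t j => hσ_flow h t ▸ hB (h * aFlow t) j
  choose m hm hm_lower hm_upper using fun h t => (hF h).exists_diagonal (hF_flow h t)
    (gauge_mul_aFlow_mul_flowDiagonal f h t) (flowDiagonal_val _ _) (flowWeight_pos _ _)
  have hrate : ∀ t (x : Fin 3 → ℝ) i h j, |x i| ≤ b * Real.exp (-a * t) *
      ‖lineProj ((gauge f h)⁻¹ • σ h) j‖ * |x j| →
        |x i| ≤ max B (b * B) * Real.exp (-a * t) * |x j| := fun t x i h j hx => by
    refine hx.trans (mul_le_mul_of_nonneg_right ?_ (abs_nonneg _))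
    calc b * Real.exp (-a * t) * ‖lineProj ((gauge f h)⁻¹ • σ h) j‖
        ≤ b * Real.exp (-a * t) * B := by gcongr; exact hB h j
      _ = b * B * Real.exp (-a * t) := by ring
      _ ≤ _ := by gcongr; exact le_max_right _ _
  have hm_pos : ∀ h t j, 0 < |m h t j| := fun h t j =>
    abs_pos.mpr (ne_zero_of_eq_mul_diagonal (hm h t) j)
  refine ⟨a, ha, max B (b * B), hB_pos.trans_le (le_max_left _ _), fun h =>
    ⟨F h, fun t j => |m h t j|, hm_pos h, (hF h).abs_le_one, fun i j =>
      ((hF h).abs_inv_le i j).trans ((hB h i).trans (le_max_left _ _)), hm_lower h,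
      fun t i j => (hm_upper h t i j).trans ?_, fun t ht i j hij => ?_, fun t ht i j hij => ?_⟩⟩
  · have hd_nonneg := (flowWeight_pos (f (h * aFlow t) - f h) t i).le
    gcongr
    exact (hB_flow h t j).trans (le_max_left _ _)
  · exact hrate t _ i h j ((hF h).abs_le_of_conjSeminorm_le (hF_flow h t) (hm h t) hij.ne
      ((hyp h (σ h) ⟨_, (hσs h).symm⟩ t ht).1 _ ((hF h).mkQ_conj_single_mem_EPlus hij)))
  · exact hrate t _ j h i ((hF h).abs_le_of_conjSeminorm_le (hF_flow h (-t)) (hm h (-t)) hij.ne'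
      ((hyp h (σ h) ⟨_, (hσs h).symm⟩ t ht).2 _ ((hF h).mkQ_conj_single_mem_EMinus hij)))

end Growth

/-! ### The three growth regimes -/

theorem exists_perm_mul_inv_eq_one {n K : Type*} [Fintype n] [DecidableEq n] [Field K]
    (F : GL n K) (hF : ∀ i j k, j ≠ k → F.1 i j * (F⁻¹).1 k i = 0) :
    ∃ τ : Equiv.Perm n, ∀ i, F.1 i (τ i) * (F⁻¹).1 (τ i) i = 1 := by
  have hsum : ∀ i i', ∑ j, F.1 i j * (F⁻¹).1 j i' = (1 : Matrix n n K) i i' := fun i i' => by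
    rw [← F.mul_inv, Matrix.mul_apply]
  have hexists : ∀ i, ∃ j, F.1 i j * (F⁻¹).1 j i ≠ 0 := fun i => by
    by_contra! hzero
    have hone := hsum i i
    rw [Finset.sum_eq_zero fun j _ => hzero j, Matrix.one_apply_eq] at hone
    exact zero_ne_one hone
  choose τ hτ using hexists
  have hτ_mul : ∀ i i', F.1 i (τ i) * (F⁻¹).1 (τ i) i' = (1 : Matrix n n K) i i' := fun i i' => by
    rw [← hsum, Finset.sum_eq_single (τ i) (fun j _ hj => ?_) (by simp)]
    rw [(mul_eq_zero.mp (hF i j (τ i) hj)).resolve_right (right_ne_zero_of_mul (hτ i)), zero_mul]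
  have hτ_inj : Function.Injective τ := fun i i' hii' => by
    by_contra hne
    have hzero := hτ_mul i i'
    rw [Matrix.one_apply_ne hne] at hzero
    exact mul_ne_zero (left_ne_zero_of_mul (hτ i)) (hii' ▸ right_ne_zero_of_mul (hτ i')) hzero
  exact ⟨Equiv.ofBijective τ (Finite.injective_iff_bijective.mp hτ_inj), fun i =>
    (hτ_mul i i).trans (Matrix.one_apply_eq i)⟩

namespace IsDominatedFrame

variable {a C : ℝ} {d m : ℝ → Fin 3 → ℝ} {F : GL (Fin 3) ℝ}

theorem abs_mul_inv_le (hF : IsDominatedFrame a C d m F) (hC : 0 < C) {t ε : ℝ} {j k : Fin 3}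
    (hjk : m t j ≤ ε * m t k) (i : Fin 3) : |F.1 i j * (F⁻¹).1 k i| ≤ C * ε := by
  refine le_of_mul_le_mul_left ?_ (hF.pos t k)
  calc m t k * |F.1 i j * (F⁻¹).1 k i| = m t k * |(F⁻¹).1 k i| * |F.1 i j| := by
        rw [abs_mul]; ring
    _ ≤ C * d t i * |F.1 i j| :=
      mul_le_mul_of_nonneg_right (hF.mul_abs_inv_le t i k) (abs_nonneg _)
    _ = C * (d t i * |F.1 i j|) := by ring
    _ ≤ C * (ε * m t k) := mul_le_mul_of_nonneg_left ((hF.mul_abs_le t i j).trans hjk) hC.le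
    _ = m t k * (C * ε) := by ring

theorem mul_inv_eq_zero (hF : IsDominatedFrame a C d m F) (ha : 0 < a) (hC : 0 < C) (i : Fin 3)
    {j k : Fin 3} (hjk : j ≠ k) : F.1 i j * (F⁻¹).1 k i = 0 := by
  have hbound : ∀ t, 0 < t → |F.1 i j * (F⁻¹).1 k i| ≤ C * (C * Real.exp (-a * t)) := by
    intro t ht
    rcases hjk.lt_or_gt with hlt | hlt
    · exact hF.abs_mul_inv_le hC (hF.le_forward t ht j k hlt) i
    · exact hF.abs_mul_inv_le hC (hF.le_backward t ht k j hlt) i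
  have hlim : Tendsto (fun t => C * (C * Real.exp (-a * t))) atTop (𝓝 0) := by
    have hexp := Real.tendsto_exp_atBot.comp
      (tendsto_id.const_mul_atTop_of_neg (neg_lt_zero.mpr ha))
    simpa using (hexp.const_mul C).const_mul C
  refine abs_eq_zero.mp ((ge_of_tendsto hlim ?_).antisymm (abs_nonneg _))
  filter_upwards [eventually_gt_atTop 0] with t ht using hbound t ht

theorem exists_perm (hF : IsDominatedFrame a C d m F) (ha : 0 < a) (hC : 0 < C) :
    ∃ τ : Equiv.Perm (Fin 3), ∀ t, 0 < t → ∀ i j, τ i < τ j →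
      d t i ≤ C ^ 3 * Real.exp (-a * t) * d t j := by
  obtain ⟨τ, hτ⟩ := exists_perm_mul_inv_eq_one F fun i j k => hF.mul_inv_eq_zero ha hC i
  have hτ_abs : ∀ i, |F.1 i (τ i)| * |(F⁻¹).1 (τ i) i| = 1 := fun i => by
    rw [← abs_mul, hτ, abs_one]
  refine ⟨τ, fun t ht i j hij => ?_⟩
  have hlower : d t i ≤ C * m t (τ i) :=
    calc d t i = d t i * |F.1 i (τ i)| * |(F⁻¹).1 (τ i) i| := by rw [mul_assoc, hτ_abs, mul_one]
      _ ≤ m t (τ i) * C := mul_le_mul (hF.mul_abs_le t _ _) (hF.abs_inv_le _ _) (abs_nonneg _)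
        (hF.pos _ _).le
      _ = C * m t (τ i) := mul_comm _ _
  have hupper : m t (τ j) ≤ C * d t j := by
    have hinv : 1 ≤ |(F⁻¹).1 (τ j) j| :=
      hτ_abs j ▸ mul_le_of_le_one_left (abs_nonneg _) (hF.abs_le_one _ _)
    exact (le_mul_of_one_le_right (hF.pos _ _).le hinv).trans (hF.mul_abs_inv_le t j (τ j))
  calc d t i ≤ C * m t (τ i) := hlower
    _ ≤ C * (C * Real.exp (-a * t) * m t (τ j)) := by
      gcongr; exact hF.le_forward t ht _ _ hij
    _ ≤ C * (C * Real.exp (-a * t) * (C * d t j)) := by gcongr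
    _ = C ^ 3 * Real.exp (-a * t) * d t j := by ring

end IsDominatedFrame

/-- Along the forward orbit of `h`, the function `f` varies at a rate less than `1`. -/
def IsSlowAt (f : H → ℝ) (a C : ℝ) (h : H) : Prop :=
  ∀ t, 0 < t → |f (h * aFlow t) - f h| ≤ (1 - a) * t + C

/-- Along the forward orbit of `h`, the function `f` grows at a rate greater than `1`. -/
def IsFastAt (f : H → ℝ) (a C : ℝ) (h : H) : Prop :=
  ∀ t, 0 < t → (1 + a) * t - C ≤ f (h * aFlow t) - f h

/-- Along each forward orbit, `f` varies at a rate less than `1`, or grows at a rate greater than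
`1`, or decreases at a rate greater than `1`; the constants do not depend on the orbit. -/
def HasThreeRegimes (f : H → ℝ) (a C : ℝ) : Prop :=
  ∀ h, IsSlowAt f a C h ∨ IsFastAt f a C h ∨ IsFastAt (-f) a C h

theorem flowWeight_le_mul_exp_mul_iff {C : ℝ} (hC : 0 < C) (x t a : ℝ) (i j : Fin 3) :
    flowWeight x t i ≤ C * Real.exp (-a * t) * flowWeight x t j ↔
      t * aWeight i + x * phiWeight i ≤
        Real.log C - a * t + (t * aWeight j + x * phiWeight j) := by
  rw [← Real.exp_log hC, flowWeight, flowWeight, ← Real.exp_add, ← Real.exp_add, Real.exp_le_exp,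
    Real.log_exp, neg_mul, ← sub_eq_add_neg]

theorem slow_or_fast_of_flowWeight_le {f : H → ℝ} {a C : ℝ} {h : H} (hC : 0 < C)
    {τ : Equiv.Perm (Fin 3)}
    (hτ : ∀ t, 0 < t → ∀ i j, τ i < τ j → flowWeight (f (h * aFlow t) - f h) t i ≤
      C * Real.exp (-a * t) * flowWeight (f (h * aFlow t) - f h) t j) :
    IsSlowAt f a (Real.log C) h ∨ IsFastAt f a (Real.log C) h ∨
      IsFastAt (-f) a (Real.log C) h := by
  simp only [flowWeight_le_mul_exp_mul_iff hC] at hτ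
  have hτ_ne : ∀ i j, i ≠ j → τ i < τ j ∨ τ j < τ i := fun i j hij => (τ.injective.ne hij).lt_or_gt
  rcases hτ_ne 0 1 (by decide) with h01 | h10
  · rcases hτ_ne 1 2 (by decide) with h12 | h21
    · refine Or.inl fun t ht => ?_
      have hlower := hτ t ht 0 1 h01
      have hupper := hτ t ht 1 2 h12
      simp only [aWeight, phiWeight, Matrix.cons_val] at hlower hupper
      exact abs_le.mpr ⟨by linarith, by linarith⟩
    · refine Or.inr (Or.inl fun t ht => ?_)
      have hlower := hτ t ht 2 1 h21
      simp only [aWeight, phiWeight, Matrix.cons_val] at hlower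
      linarith
  · refine Or.inr (Or.inr fun t ht => ?_)
    have hupper := hτ t ht 1 0 h10
    simp only [aWeight, phiWeight, Matrix.cons_val] at hupper
    rw [Pi.neg_apply, Pi.neg_apply]
    linarith

theorem IsAnosov.exists_hasThreeRegimes {Γ : Type*} [Group Γ] {ι : Γ →* H}
    (hinj : Function.Injective ι) [DiscreteTopology ι.range] [CompactSpace (M ι)]
    {u : Γ →* Multiplicative ℝ} (hA : IsAnosov ι (linearDeformation ι u)) {f : H → ℝ}
    (hf : Continuous f) (hfu : ∀ γ h, f (ι γ * h) = f h + (u γ).toAdd) :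
    ∃ a > 0, ∃ C, HasThreeRegimes f a C := by
  obtain ⟨s, hs⟩ := hA
  obtain ⟨a, ha, C, hC, hdom⟩ := hs.exists_isDominatedFrame hinj hf hfu
  refine ⟨a, ha, Real.log (C ^ 3), fun h => ?_⟩
  obtain ⟨F, m, hF⟩ := hdom h
  obtain ⟨τ, hτ⟩ := hF.exists_perm ha hC
  exact slow_or_fast_of_flowWeight_le (pow_pos hC 3) hτ

/-! ### Rotations and the Cartan decomposition -/

/-- The rotation of the plane by the angle `θ`, as an element of the maximal compact subgroup of
`SL(2, ℝ)`. -/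
def rot (θ : ℝ) : H :=
  ⟨!![Real.cos θ, -Real.sin θ; Real.sin θ, Real.cos θ], by
    rw [Matrix.det_fin_two_of]; linarith [Real.sin_sq_add_cos_sq θ]⟩

theorem continuous_rot : Continuous rot :=
  Continuous.subtype_mk (by fun_prop) _

theorem rot_zero : rot 0 = 1 := by
  ext i j
  fin_cases i <;> fin_cases j <;> simp [rot]

theorem rot_inv (θ : ℝ) : (rot θ)⁻¹ = rot (-θ) := by
  ext i j
  rw [Matrix.SpecialLinearGroup.coe_inv, Matrix.adjugate_fin_two]
  fin_cases i <;> fin_cases j <;> simp [rot]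

theorem periodic_rot : Function.Periodic rot (2 * Real.pi) := fun θ => by
  ext i j
  fin_cases i <;> fin_cases j <;> simp [rot]

theorem rot_half_pi_mul_aFlow (t : ℝ) :
    rot (Real.pi / 2) * aFlow t = aFlow (-t) * rot (Real.pi / 2) := by
  refine Subtype.ext ?_
  rw [Matrix.SpecialLinearGroup.coe_mul, Matrix.SpecialLinearGroup.coe_mul]
  ext i j
  fin_cases i <;> fin_cases j <;> simp [rot, aFlow, Matrix.mul_apply, Fin.sum_univ_two]

theorem norm_rot_le (θ : ℝ) : ‖(rot θ).1‖ ≤ 2 := by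
  rw [linfty_opNorm_le_iff zero_le_two]
  intro i
  fin_cases i <;> simp [rot] <;> linarith [Real.abs_sin_le_one θ, Real.abs_cos_le_one θ]

theorem exists_rot_orthogonal_cols (A : Matrix (Fin 2) (Fin 2) ℝ) :
    ∃ θ, (A * (rot θ).1).col 0 ⬝ᵥ (A * (rot θ).1).col 1 = 0 := by
  set q : ℝ → ℝ := fun θ => (A * (rot θ).1).col 0 ⬝ᵥ (A * (rot θ).1).col 1 with hq
  have continuous_q : Continuous q := by
    have continuous_mul_rot : Continuous fun θ => A * (rot θ).1 :=
      continuous_const.mul (continuous_subtype_val.comp continuous_rot)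
    exact (continuous_pi fun i => continuous_mul_rot.matrix_elem i 0).dotProduct
      (continuous_pi fun i => continuous_mul_rot.matrix_elem i 1)
  -- A quarter turn exchanges the two columns up to sign.
  have q_half_pi : q (Real.pi / 2) = -q 0 := by
    simp [hq, rot, dotProduct, Matrix.mul_apply, Fin.sum_univ_two]
    ring
  rcases le_total 0 (q 0) with h0 | h0
  · exact mem_range_of_exists_le_of_exists_ge continuous_q ⟨Real.pi / 2, by linarith⟩ ⟨0, h0⟩
  · exact mem_range_of_exists_le_of_exists_ge continuous_q ⟨0, h0⟩ ⟨Real.pi / 2, by linarith⟩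

theorem exists_eq_rot_mul_aFlow (X : H) (horth : X.1.col 0 ⬝ᵥ X.1.col 1 = 0) :
    ∃ ψ t, X = rot ψ * aFlow t := by
  set z : ℂ := ⟨X.1 0 0, X.1 1 0⟩
  have hdet : X.1 0 0 * X.1 1 1 - X.1 0 1 * X.1 1 0 = 1 := Matrix.det_fin_two X.1 ▸ X.2
  rw [dotProduct, Fin.sum_univ_two] at horth
  change X.1 0 0 * X.1 0 1 + X.1 1 0 * X.1 1 1 = 0 at horth
  have norm_sq_z : ‖z‖ ^ 2 = X.1 0 0 ^ 2 + X.1 1 0 ^ 2 := by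
    rw [Complex.sq_norm, Complex.normSq_apply, pow_two, pow_two]
  have norm_z_ne_zero : ‖z‖ ≠ 0 := fun hz => by
    have hsum : X.1 0 0 ^ 2 + X.1 1 0 ^ 2 = 0 := by rw [← norm_sq_z, hz, zero_pow two_ne_zero]
    have h00 : X.1 0 0 = 0 := by nlinarith
    have h10 : X.1 1 0 = 0 := by nlinarith
    rw [h00, h10] at hdet
    simp at hdet
  have norm_z_pos : 0 < ‖z‖ := (norm_nonneg z).lt_of_ne' norm_z_ne_zero
  have hcos : ‖z‖ * Real.cos z.arg = X.1 0 0 := Complex.norm_mul_cos_arg z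
  have hsin : ‖z‖ * Real.sin z.arg = X.1 1 0 := Complex.norm_mul_sin_arg z
  have h01 : X.1 0 1 = -Real.sin z.arg * ‖z‖⁻¹ := by
    rw [eq_mul_inv_iff_mul_eq₀ norm_z_ne_zero]
    refine mul_right_cancel₀ norm_z_ne_zero ?_
    linear_combination X.1 0 1 * norm_sq_z + hsin + X.1 0 0 * horth - X.1 1 0 * hdet
  have h11 : X.1 1 1 = Real.cos z.arg * ‖z‖⁻¹ := by
    rw [eq_mul_inv_iff_mul_eq₀ norm_z_ne_zero]
    refine mul_right_cancel₀ norm_z_ne_zero ?_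
    linear_combination X.1 1 1 * norm_sq_z - hcos + X.1 1 0 * horth + X.1 0 0 * hdet
  refine ⟨z.arg, Real.log ‖z‖, Subtype.ext ?_⟩
  rw [Matrix.SpecialLinearGroup.coe_mul]
  ext i j
  rw [Matrix.mul_apply, Fin.sum_univ_two]
  fin_cases i <;> fin_cases j <;>
    simp [rot, aFlow, Real.exp_neg, Real.exp_log norm_z_pos, h01, h11, ← hcos, ← hsin, mul_comm]

theorem exp_abs_le_norm_aFlow (t : ℝ) : Real.exp |t| ≤ ‖(aFlow t).1‖ := by
  rcases abs_choice t with ht | ht <;> rw [ht]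
  · simpa [aFlow] using norm_entry_le_linfty_opNorm (aFlow t).1 0 0
  · simpa [aFlow] using norm_entry_le_linfty_opNorm (aFlow t).1 1 1

theorem exists_cartan (A : H) :
    ∃ θ ψ t, A * rot θ = rot ψ * aFlow t ∧ Real.exp |t| ≤ 4 * ‖A.1‖ := by
  obtain ⟨θ, hθ⟩ := exists_rot_orthogonal_cols A.1
  obtain ⟨ψ, t, hψ⟩ := exists_eq_rot_mul_aFlow (A * rot θ) hθ
  refine ⟨θ, ψ, t, hψ, (exp_abs_le_norm_aFlow t).trans ?_⟩
  have haFlow : aFlow t = rot (-ψ) * (A * rot θ) := by rw [hψ, ← rot_inv, inv_mul_cancel_left]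
  calc ‖(aFlow t).1‖ = ‖(rot (-ψ)).1 * (A.1 * (rot θ).1)‖ := by rw [haFlow]; rfl
    _ ≤ ‖(rot (-ψ)).1‖ * (‖A.1‖ * ‖(rot θ).1‖) :=
      (norm_mul_le _ _).trans (mul_le_mul_of_nonneg_left (norm_mul_le _ _) (norm_nonneg _))
    _ ≤ 2 * (‖A.1‖ * 2) := by gcongr <;> exact norm_rot_le _
    _ = 4 * ‖A.1‖ := by ring

theorem exists_abs_sub_rot_le {Γ : Type*} [Group Γ] {ι : Γ →* H} [CompactSpace (M ι)]
    {u : Γ →* Multiplicative ℝ} {f : H → ℝ} (hf : Continuous f)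
    (hfu : ∀ γ h, f (ι γ * h) = f h + (u γ).toAdd) :
    ∃ B > 0, ∀ h θ, |f (h * rot θ) - f h| ≤ B := by
  have hcont : Continuous (Function.uncurry fun h θ => f (h * rot θ) - f h) :=
    (hf.comp (continuous_fst.mul (continuous_rot.comp continuous_snd))).sub
      (hf.comp continuous_fst)
  obtain ⟨B, hB, hbound⟩ := exists_norm_le_of_invariant hcont
    (fun γ h => funext fun θ => by rw [mul_assoc, hfu, hfu, add_sub_add_right_eq_sub])
    (isCompact_Icc (a := 0) (b := 2 * Real.pi))
  refine ⟨B, hB, fun h θ => ?_⟩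
  obtain ⟨θ', hθ', heq⟩ := periodic_rot.exists_mem_Ico₀ Real.two_pi_pos θ
  rw [heq]
  exact hbound h θ' (Set.Ico_subset_Icc_self hθ')

/-! ### Excluding the fast regimes -/

namespace HasThreeRegimes

variable {f : H → ℝ} {a C : ℝ}

theorem neg (hf : HasThreeRegimes f a C) : HasThreeRegimes (-f) a C := fun h => by
  have isSlowAt_neg : IsSlowAt (-f) a C h ↔ IsSlowAt f a C h := by
    simp only [IsSlowAt, Pi.neg_apply, neg_sub_neg, abs_sub_comm]
  rw [isSlowAt_neg, neg_neg, or_comm (a := IsFastAt (-f) a C h)]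
  exact hf h

theorem isFastAt_tfae (hf : HasThreeRegimes f a C) {t : ℝ} (ht : 0 < t) (hC : |C| < a * t)
    (h : H) : [IsFastAt f a C h, t < f (h * aFlow t) - f h, t ≤ f (h * aFlow t) - f h].TFAE := by
  have hC' := abs_lt.mp hC
  tfae_have 1 → 2 := fun hfast => by linarith [hfast t ht]
  tfae_have 2 → 3 := le_of_lt
  tfae_have 3 → 1 := fun hle => by
    rcases hf h with hslow | hfast | hfast
    · linarith [le_of_abs_le (hslow t ht)]
    · exact hfast
    · have hneg := hfast t ht
      simp only [Pi.neg_apply] at hneg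
      linarith
  tfae_finish

theorem isClopen_setOf_isFastAt (hf : HasThreeRegimes f a C) (ha : 0 < a) (hcont : Continuous f) :
    IsClopen {h | IsFastAt f a C h} := by
  obtain ⟨t, ht, hC⟩ : ∃ t, 0 < t ∧ |C| < a * t :=
    ⟨(|C| + 1) / a, by positivity, by rw [mul_div_cancel₀ _ ha.ne']; linarith⟩
  have hincr : Continuous fun h => f (h * aFlow t) - f h := by fun_prop
  constructor
  · simpa only [(hf.isFastAt_tfae ht hC _).out 0 2] using isClosed_le continuous_const hincr
  · simpa only [(hf.isFastAt_tfae ht hC _).out 0 1] using isOpen_lt continuous_const hincr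

theorem isFastAt_of_path (hf : HasThreeRegimes f a C) (ha : 0 < a) (hcont : Continuous f)
    {p : ℝ → H} (hp : Continuous p) {x : ℝ} (hx : IsFastAt f a C (p x)) (y : ℝ) :
    IsFastAt f a C (p y) :=
  Set.eq_univ_iff_forall.mp (((hf.isClopen_setOf_isFastAt ha hcont).preimage hp).eq_univ ⟨x, hx⟩) y

/-- The quarter turn conjugates `aFlow t` to `aFlow (-t)`. By connectedness a fast orbit and its
quarter turn would both be fast, but `f` would increase along one of them while decreasing along
the other, and the two stay at bounded distance. -/
theorem not_isFastAt (hf : HasThreeRegimes f a C) (ha : 0 < a) (hcont : Continuous f) {B : ℝ}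
    (hB : ∀ h θ, |f (h * rot θ) - f h| ≤ B) (h : H) : ¬ IsFastAt f a C h := by
  intro hfast
  have hB_nonneg : 0 ≤ B := (abs_nonneg _).trans (hB h 0)
  obtain ⟨T, hT, hlarge⟩ : ∃ T, 0 < T ∧ C + B < (1 + a) * T := by
    refine ⟨|C| + B + 1, by positivity, ?_⟩
    nlinarith [le_abs_self C, abs_nonneg C]
  have hturned : IsFastAt f a C (h * rot (Real.pi / 2)) :=
    hf.isFastAt_of_path ha hcont (continuous_const.mul continuous_rot) (x := 0)
      (by simpa [rot_zero] using hfast) _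
  have hbackward : IsFastAt f a C (h * aFlow (-T)) :=
    hf.isFastAt_of_path ha hcont (continuous_const.mul continuous_aFlow) (x := 0)
      (by simpa [aFlow_zero] using hfast) _
  have hgrowth_turned := hturned T hT
  have hgrowth_backward := hbackward T hT
  rw [mul_assoc, rot_half_pi_mul_aFlow, ← mul_assoc] at hgrowth_turned
  rw [mul_assoc, ← aFlow_add, neg_add_cancel, aFlow_zero, mul_one] at hgrowth_backward
  linarith [le_of_abs_le (hB (h * aFlow (-T)) (Real.pi / 2)),
    neg_le_of_abs_le (hB h (Real.pi / 2))]

theorem hasSlowIncrements (hf : HasThreeRegimes f a C) (ha : 0 < a) (hcont : Continuous f) {B : ℝ}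
    (hB : ∀ h θ, |f (h * rot θ) - f h| ≤ B) : HasSlowIncrements f := by
  have hB_neg : ∀ h θ, |(-f) (h * rot θ) - (-f) h| ≤ B := fun h θ => by
    rw [Pi.neg_apply, Pi.neg_apply, neg_sub_neg, abs_sub_comm]
    exact hB h θ
  have hslow : ∀ h, IsSlowAt f a C h := fun h =>
    (hf h).resolve_right (not_or.mpr
      ⟨hf.not_isFastAt ha hcont hB h, hf.neg.not_isFastAt ha hcont.neg hB_neg h⟩)
  refine ⟨a, ha, |C|, fun h t => ?_⟩
  have hC := le_abs_self C
  rcases lt_trichotomy t 0 with ht | rfl | ht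
  · have hbackward := hslow (h * aFlow t) (-t) (neg_pos.mpr ht)
    rw [mul_aFlow_mul_aFlow_neg, abs_sub_comm] at hbackward
    rw [abs_of_neg ht]
    linarith
  · simp [aFlow_zero]
  · rw [abs_of_pos ht]
    linarith [hslow h t ht]

end HasThreeRegimes

theorem IsAnosov.hasSlowIncrements {Γ : Type*} [Group Γ] {ι : Γ →* H}
    (hinj : Function.Injective ι) [DiscreteTopology ι.range] [CompactSpace (M ι)]
    {u : Γ →* Multiplicative ℝ} (hA : IsAnosov ι (linearDeformation ι u)) {f : H → ℝ}
    (hf : Continuous f) (hfu : ∀ γ h, f (ι γ * h) = f h + (u γ).toAdd) : HasSlowIncrements f := by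
  obtain ⟨a, ha, C, hregimes⟩ := hA.exists_hasThreeRegimes hinj hf hfu
  obtain ⟨B, -, hB⟩ := exists_abs_sub_rot_le hf hfu
  exact hregimes.hasSlowIncrements ha hf hB

/-! ### Slow increments bound the periods -/

section Periods

variable {Γ : Type*} [Group Γ] {ι : Γ →* H} [CompactSpace (M ι)] {u : Γ →* Multiplicative ℝ}
  {f : H → ℝ}

theorem exists_abs_period_le_log_norm (hf : Continuous f)
    (hfu : ∀ γ h, f (ι γ * h) = f h + (u γ).toAdd) {b C : ℝ} (hb : 0 ≤ b)
    (hincr : ∀ h t, |f (h * aFlow t) - f h| ≤ b * |t| + C) :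
    ∃ D, ∀ γ, |(u γ).toAdd| ≤ b * Real.log (4 * ‖(ι γ).1‖) + D := by
  obtain ⟨B, -, hB⟩ := exists_abs_sub_rot_le hf hfu
  refine ⟨C + 2 * B, fun γ => ?_⟩
  obtain ⟨θ, ψ, t, hcartan, ht⟩ := exists_cartan (ι γ)
  have hlog : |t| ≤ Real.log (4 * ‖(ι γ).1‖) :=
    (Real.le_log_iff_exp_le ((Real.exp_pos _).trans_le ht)).mpr ht
  have hperiod : (u γ).toAdd = f (ι γ) - f 1 := by rw [← mul_one (ι γ), hfu]; ring
  have hright := hB (ι γ) θ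
  have hleft := hB 1 ψ
  rw [hcartan, abs_sub_comm] at hright
  rw [one_mul] at hleft
  calc |(u γ).toAdd|
      = |(f (ι γ) - f (rot ψ * aFlow t)) + (f (rot ψ * aFlow t) - f (rot ψ)) +
          (f (rot ψ) - f 1)| := by rw [hperiod]; congr 1; ring
    _ ≤ B + (b * |t| + C) + B :=
      (abs_add_three _ _ _).trans (add_le_add_three hright (hincr _ _) hleft)
    _ ≤ b * Real.log (4 * ‖(ι γ).1‖) + (C + 2 * B) := by
      linarith [mul_le_mul_of_nonneg_left hlog hb]

theorem exists_abs_period_le_log_specRadius (hf : Continuous f)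
    (hfu : ∀ γ h, f (ι γ * h) = f h + (u γ).toAdd) {b C : ℝ} (hb : 0 ≤ b)
    (hincr : ∀ h t, |f (h * aFlow t) - f h| ≤ b * |t| + C) :
    ∃ D, ∀ γ, |(u γ).toAdd| ≤ b * Real.log (specRadius ι γ) + D := by
  obtain ⟨D, hD⟩ := exists_abs_period_le_log_norm hf hfu hb hincr
  obtain ⟨L, hL, hconj⟩ := exists_conj_norm_le_specRadius (ι := ι)
  refine ⟨b * Real.log (4 * L) + D, fun γ => ?_⟩
  obtain ⟨δ, hδ⟩ := hconj γ
  have hr := one_le_specRadius (ι := ι) γ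
  have hperiod : (u (δ⁻¹ * γ * δ)).toAdd = (u γ).toAdd := by
    simp only [map_mul, map_inv, toAdd_mul, toAdd_inv]; ring
  have hnorm_pos : 0 < ‖(ι (δ⁻¹ * γ * δ)).1‖ :=
    one_pos.trans_le ((one_le_specRadius (δ⁻¹ * γ * δ)).trans (specRadius_le_norm _))
  have hlog : Real.log (4 * ‖(ι (δ⁻¹ * γ * δ)).1‖) ≤
      Real.log (4 * L) + Real.log (specRadius ι γ) := by
    rw [← Real.log_mul (by positivity) (by positivity), mul_assoc 4 L]
    gcongr
  calc |(u γ).toAdd| ≤ b * Real.log (4 * ‖(ι (δ⁻¹ * γ * δ)).1‖) + D := hperiod ▸ hD (δ⁻¹ * γ * δ)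
    _ ≤ b * (Real.log (4 * L) + Real.log (specRadius ι γ)) + D := by gcongr
    _ = b * Real.log (specRadius ι γ) + (b * Real.log (4 * L) + D) := by ring

end Periods

theorem le_of_forall_nat_mul_le_add {x y D : ℝ} (h : ∀ n : ℕ, n * x ≤ n * y + D) : x ≤ y := by
  by_contra! hlt
  obtain ⟨n, hn⟩ := exists_nat_gt (D / (x - y))
  rw [div_lt_iff₀ (sub_pos.mpr hlt)] at hn
  linarith [h n]

theorem HasSlowIncrements.exists_period_le {Γ : Type*} [Group Γ] {ι : Γ →* H}
    [CompactSpace (M ι)] {u : Γ →* Multiplicative ℝ} {f : H → ℝ} (hslow : HasSlowIncrements f)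
    (hf : Continuous f) (hfu : ∀ γ h, f (ι γ * h) = f h + (u γ).toAdd) :
    ∃ κ, 0 < κ ∧ κ < 1 / 2 ∧ ∀ γ, |(u γ).toAdd| ≤ κ * transLength ι γ := by
  obtain ⟨a, ha, C, hincr⟩ := hslow
  obtain ⟨b, hb, hb_lt, hab⟩ : ∃ b, 0 < b ∧ b < 1 ∧ 1 - a ≤ b :=
    ⟨max (1 - a) (1 / 2), by positivity, max_lt (by linarith) (by norm_num), le_max_left _ _⟩
  obtain ⟨D, hD⟩ := exists_abs_period_le_log_specRadius hf hfu hb.le fun h t =>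
    (hincr h t).trans (by gcongr)
  refine ⟨b / 2, by positivity, by linarith, fun γ =>
    le_of_forall_nat_mul_le_add (D := D) fun n => ?_⟩
  calc n * |(u γ).toAdd| = |(u (γ ^ n)).toAdd| := by
        rw [map_pow, toAdd_pow, nsmul_eq_mul, abs_mul, Nat.abs_cast]
    _ ≤ b * Real.log (specRadius ι (γ ^ n)) + D := hD _
    _ = n * (b / 2 * transLength ι γ) + D := by
        rw [specRadius_pow, Real.log_pow, transLength]; ring

end FlagAnosov

end

theorem mainTheorem2_general {Γ : Type*} [Group Γ] {ι : Γ →* FlagAnosov.H}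
    (hinj : Function.Injective ι) [DiscreteTopology ι.range] [CompactSpace (FlagAnosov.M ι)]
    (u : Γ →* Multiplicative ℝ) :
    FlagAnosov.IsAnosov ι (FlagAnosov.linearDeformation ι u) ↔
      FlagAnosov.stableNorm ι u < 1 / 2 := by
  obtain ⟨f, hf, hfu⟩ := FlagAnosov.exists_continuous_equivariant hinj u
  have half_eq : (1 / 2 : ENNReal) = ENNReal.ofReal (1 / 2) := by
    rw [ENNReal.ofReal_div_of_pos two_pos, ENNReal.ofReal_one, ENNReal.ofReal_ofNat]
  rw [half_eq, FlagAnosov.stableNorm_lt_ofReal_iff one_half_pos]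
  constructor
  · intro hA
    exact (hA.hasSlowIncrements hinj hf hfu).exists_period_le hf hfu
  · rintro ⟨κ, hκ_pos, hκ, hu⟩
    exact (FlagAnosov.HasSlowIncrements.of_period_le hf hfu hκ_pos.le hκ hu).isAnosov hf hfu

theorem mainTheorem2 {Γ : Type*} [Group Γ] (ι : Γ →* FlagAnosov.H)
    (hι : FlagAnosov.IsClosedSurfaceEmbedding ι) (u : Γ →* Multiplicative ℝ) :
    FlagAnosov.IsAnosov ι (FlagAnosov.linearDeformation ι u) ↔
      FlagAnosov.stableNorm ι u < 1 / 2 := by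
  have := hι.discrete
  have := hι.cocompact
  exact mainTheorem2_general hι.injective u
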